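/- Let $n\ge 1$, let $B=\{z\in\mathbb C^n:|z|<1\}$ be the open unit ball, $S$ its boundary sphere, $V$ the normalized volume measure on $B$, $\sigma$ the normalized surface measure on $S$, and $\langle z,a\rangle=\sum_j z_j\overline{a_j}$. For $a\in B$ let $$\Phi_a(z)=\frac{a-P_az-\sqrt{1-|a|^2}\,(z-P_az)}{1-\langle z,a\rangle},$$ where $P_a$ is the orthogonal projection of $\mathbb C^n$ onto the span of $a$. For $p>0$, $\mathcal N_p$ is the space of holomorphic $f$ on $B$ with $$\|f\|_p=\sup_{a\in B}\Big(\int_B|f(z)|^2(1-|\Phi_a(z)|^2)^p\,dV(z)\Big)^{1/2}<\infty,$$ and $\mathcal N_p^0$ is the space of all $f\in\mathcal N_p$ with $\lim_{|a|\to1^-}\int_B|f(z)|^2(1-|\Phi_a(z)|^2)^p\,dV(z)=0$. Let $(T_k)_{k\ge0}$ be a sequence of Ryll–Wojtaszczyk polynomials, that is, each $T_k$ is a homogeneous polynomial of degree $k$ on $\mathbb C^n$ with $$\sup_{\xi\in S}|T_k(\xi)|=1\quad\text{and}\quad\int_S|T_k(\xi)|^2\,d\sigma(\xi)\ge\frac{\pi}{2^{2n}}.$$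 Let $0<p\le n$, let $(n_k)_{k\ge0}$ be positive integers with Hadamard gaps, i.e. for some $c>1$, $n_{k+1}/n_k\ge c$ for all $k\ge0$, let $a_k\in\mathbb C$, and let $f(z)=\sum_{k=0}^\infty a_kT_{n_k}(z)$ be holomorphic on $B$ (the series converging at every point of $B$). Then the following statements are equivalent: (a) $\displaystyle\sum_{k=0}^\infty\Big(\frac1{2^{k(1+p)}}\sum_{2^k\le n_j<2^{k+1}}|a_j|^2\Big)<\infty$; (b) $f\in\mathcal N_p^0$; (c) $f\in\mathcal N_p$. -/

import Mathlib

open MeasureTheory Filter Topology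
open scoped ENNReal

namespace HadamardNp

noncomputable section

/-- Complex `n`-space with the Hermitian inner product and the Euclidean norm. -/
abbrev Cn (n : ℕ) : Type := EuclideanSpace ℂ (Fin n)

/-- The open unit ball of `ℂⁿ`. -/
def unitBall (n : ℕ) : Set (Cn n) := Metric.ball 0 1

/-- The unit sphere of `ℂⁿ`. -/
abbrev unitSphere (n : ℕ) : Set (Cn n) := Metric.sphere 0 1

/-- The normalized volume measure on the unit ball (Lebesgue measure restricted to the
ball and divided by the volume of the ball). -/
def ballMeasure (n : ℕ) : Measure (Cn n) := ProbabilityTheory.cond volume (unitBall n)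

/-- The normalized surface measure on the unit sphere. -/
def sphereMeasure (n : ℕ) : Measure (unitSphere n) :=
  ((volume : Measure (Cn n)).toSphere Set.univ)⁻¹ • (volume : Measure (Cn n)).toSphere

/-- The orthogonal projection of `ℂⁿ` onto the complex line (or point) spanned by `a`. -/
def proj {n : ℕ} (a z : Cn n) : Cn n := (Submodule.span ℂ {a}).starProjection z

/-- The involutive automorphism of the unit ball that exchanges `0` and `a`:
`Φ_a(z) = (a - P_a z - s_a Q_a z) / (1 - ⟨z, a⟩)` with `s_a = √(1 - |a|²)`,
`Q_a = I - P_a` and `⟨z, a⟩ = ∑ z_j conj(a_j)` (Mathlib's `inner ℂ a z`). -/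
def ballAut {n : ℕ} (a z : Cn n) : Cn n :=
  (1 - inner ℂ a z)⁻¹ •
    (a - proj a z - ((Real.sqrt (1 - ‖a‖ ^ 2) : ℝ) : ℂ) • (z - proj a z))

/-- The integral `∫_B |f(z)|² (1 - |Φ_a(z)|²)^p dV(z)`, with values in `[0, ∞]`. -/
def npIntegral {n : ℕ} (p : ℝ) (f : Cn n → ℂ) (a : Cn n) : ℝ≥0∞ :=
  ∫⁻ z, ENNReal.ofReal (‖f z‖ ^ 2 * (1 - ‖ballAut a z‖ ^ 2) ^ p) ∂(ballMeasure n)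

/-- The `N_p`-norm, with values in `[0, ∞]`. -/
def npNorm {n : ℕ} (p : ℝ) (f : Cn n → ℂ) : ℝ≥0∞ :=
  ⨆ a ∈ unitBall n, npIntegral p f a ^ (1 / 2 : ℝ)

/-- `f` belongs to `N_p(B)`: it is holomorphic in the ball and has finite `N_p`-norm. -/
def MemNp {n : ℕ} (p : ℝ) (f : Cn n → ℂ) : Prop :=
  DifferentiableOn ℂ f (unitBall n) ∧ npNorm p f < ∞

/-- `f` belongs to the little space `N_p^0(B)`: it is in `N_p(B)` and the defining integral
tends to `0` as `|a| → 1⁻`. -/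
def MemNpZero {n : ℕ} (p : ℝ) (f : Cn n → ℂ) : Prop :=
  MemNp p f ∧ Tendsto (npIntegral p f) (comap (fun a : Cn n => ‖a‖) (𝓝[<] 1)) (𝓝 0)

/-- The value at `z` of a polynomial in `n` complex variables. -/
def polyEval {n : ℕ} (P : MvPolynomial (Fin n) ℂ) (z : Cn n) : ℂ :=
  MvPolynomial.eval (fun i => z i) P

/-- A sequence of Ryll–Wojtaszczyk polynomials: `T k` is homogeneous of degree `k`, its
supremum norm on the sphere is `1`, and its squared `L²`-norm is at least `π / 2^(2n)`. -/
structure IsRyllWojtaszczyk {n : ℕ} (T : ℕ → MvPolynomial (Fin n) ℂ) : Prop where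
  homogeneous : ∀ k, (T k).IsHomogeneous k
  sup_eq_one : ∀ k, IsLUB (Set.range fun ξ : unitSphere n => ‖polyEval (T k) ξ‖) 1
  le_l2 : ∀ k, Real.pi / 2 ^ (2 * n) ≤
    ∫ ξ : unitSphere n, ‖polyEval (T k) ξ‖ ^ 2 ∂(sphereMeasure n)

/-- A Hadamard gap sequence of (positive) degrees. -/
def IsHadamardGap (d : ℕ → ℕ) : Prop :=
  (∀ k, 0 < d k) ∧ ∃ c : ℝ, 1 < c ∧ ∀ k, c ≤ (d (k + 1) : ℝ) / (d k : ℝ)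

/-- The dyadic sum `∑_k 2^{-k(1+p)} ∑_{2^k ≤ d_j < 2^{k+1}} |a_j|²`, with values in `[0, ∞]`. -/
def dyadicSum (p : ℝ) (d : ℕ → ℕ) (a : ℕ → ℂ) : ℝ≥0∞ :=
  ∑' k : ℕ, ENNReal.ofReal (1 / 2 ^ ((k : ℝ) * (1 + p))) *
    ∑' j : {j : ℕ // 2 ^ k ≤ d j ∧ d j < 2 ^ (k + 1)}, ENNReal.ofReal (‖a j‖ ^ 2)

end

end HadamardNp

/-!
The three statements are compared with the weighted sum `W = ∑ |a_j|² d_j^{-(1+p)}`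
(`weightedSum`), which is comparable with the dyadic sum.

*Membership in `N_p` forces `W < ∞`.* At `a = 0` the defining integral is
`∫_B |f|² (1 - |z|²)^p dV`. Volume is invariant under `z ↦ e^{iθ} z`, and on each slice
`θ ↦ f(e^{iθ} z) = ∑ a_j T_{d_j}(z) e^{i d_j θ}` Bessel's inequality applies. Averaging over `θ`
gives the lower bound `∑ |a_j|² ∫_B |T_{d_j}|² (1 - |z|²)^p dV` (`tsum_lintegral_le`). In polar
coordinates, the `L²` bound on the polynomials and a Beta integral bound the `j`-th integral below
by a multiple of `d_j^{-(1+p)}` (`exists_le_lintegral_polyEval_ball`).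

*`W < ∞` gives membership in the little space.* Since `|T_k(z)| ≤ |z|^k`, `f` has the radial
majorant `∑ |a_j| r^{d_j}`, `r = |z|`. Cauchy–Schwarz with the weights `d_j^p r^{d_j}`, whose sum is
`O((1 - r)^{-p})` by the gap condition (`IsHadamardGap.sum_rpow_mul_pow_le`), bounds
`|f(z)|² (1 - |z|²)^p` by a multiple of `G(r) = ∑ |a_j|² d_j^{-p} r^{d_j}`
(`exists_norm_sq_mul_le_radialMajorant`), and `∫_0^1 G ≤ W`. By the identity
`1 - |Φ_a(z)|² = (1 - |a|²)(1 - |z|²) / |1 - ⟨z, a⟩|²` (`one_sub_norm_ballAut_sq`), what is left of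
the integrand is the kernel `((1 - |a|²) / |1 - ⟨z, a⟩|²)^p`. Its integrals over the spheres
`|z| = r` are bounded uniformly in `a` and `r` because `p ≤ n` (`exists_lintegral_szegoKernel_le`),
and tend to zero as `|a| → 1` for fixed `r < 1`. So the integrals are bounded, and they tend to zero
by dominated convergence in `r`.

The kernel bound reduces to the exponent `n`. By homogeneity, `∫_S |1 - ⟨ξ, b⟩|^{-2n}` is a constant
times the volume of `{z : ||z| - ⟨z, b⟩| < 1}`; completing a square puts this set into a box of
volume `O((1 - |b|²)^{-n})` (`exists_volume_sublevel_le`).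
-/

namespace HadamardNp

/-! ### The Möbius identity for the ball automorphisms -/

/-- By Cauchy–Schwarz, `1 - ⟨z, a⟩` has positive modulus on the ball. -/
lemma norm_one_sub_inner_pos {n : ℕ} {a z : Cn n} (ha : ‖a‖ < 1) (hz : ‖z‖ ≤ 1) :
    0 < ‖1 - inner ℂ a z‖ := by
  have h1 : ‖inner ℂ a z‖ ≤ ‖a‖ * ‖z‖ := norm_inner_le_norm a z
  have h2 : ‖a‖ * ‖z‖ ≤ ‖a‖ := mul_le_of_le_one_right (norm_nonneg a) hz
  have h3 := norm_sub_norm_le (1 : ℂ) (inner ℂ a z)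
  rw [norm_one] at h3
  linarith

lemma one_sub_norm_sq_pos {n : ℕ} {a : Cn n} (ha : ‖a‖ < 1) : 0 < 1 - ‖a‖ ^ 2 := by
  nlinarith [norm_nonneg a]

theorem one_sub_norm_ballAut_sq {n : ℕ} {a z : Cn n} (ha : ‖a‖ < 1) (hz : ‖z‖ < 1) :
    1 - ‖ballAut a z‖ ^ 2 =
      (1 - ‖a‖ ^ 2) * (1 - ‖z‖ ^ 2) / ‖1 - inner ℂ a z‖ ^ 2 := by
  have hpos := norm_one_sub_inner_pos ha hz.le
  set P := proj a z with hP
  have hPmem : P ∈ Submodule.span ℂ {a} := Submodule.starProjection_apply_mem _ _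
  have haS : a ∈ Submodule.span ℂ {a} := Submodule.mem_span_singleton_self a
  have hQ : ∀ w ∈ Submodule.span ℂ {a}, inner ℂ w (z - P) = 0 := fun w hw =>
    Submodule.sub_starProjection_mem_orthogonal z w hw
  have haP : inner ℂ a P = inner ℂ a z := by
    have := hQ a haS
    rw [inner_sub_right, sub_eq_zero] at this
    exact this.symm
  -- `P` is a multiple of `a`, which turns Cauchy–Schwarz into an equality.
  have hcs : ‖a‖ ^ 2 * ‖P‖ ^ 2 = ‖(inner ℂ a z : ℂ)‖ ^ 2 := by
    obtain ⟨c, hc⟩ := Submodule.mem_span_singleton.1 hPmem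
    rw [← haP, ← hc, inner_smul_right, norm_smul, norm_mul, inner_self_eq_norm_sq_to_K]
    simp
    ring
  have hz2 : ‖z‖ ^ 2 = ‖P‖ ^ 2 + ‖z - P‖ ^ 2 := by
    have h := norm_add_sq_eq_norm_sq_add_norm_sq_of_inner_eq_zero P (z - P) (hQ P hPmem)
    rw [add_sub_cancel] at h
    nlinarith [h]
  set s : ℝ := Real.sqrt (1 - ‖a‖ ^ 2) with hs
  have hs2 : s ^ 2 = 1 - ‖a‖ ^ 2 := Real.sq_sqrt (one_sub_norm_sq_pos ha).le
  have hN : ‖a - P - (s : ℂ) • (z - P)‖ ^ 2 = ‖a - P‖ ^ 2 + s ^ 2 * ‖z - P‖ ^ 2 := by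
    have h0 : inner ℂ (a - P) ((s : ℂ) • (z - P)) = 0 := by
      rw [inner_smul_right, hQ _ (Submodule.sub_mem _ haS hPmem), mul_zero]
    have h := norm_sub_sq (𝕜 := ℂ) (a - P) ((s : ℂ) • (z - P))
    rw [h0, norm_smul, mul_pow] at h
    simpa using h
  have haP2 : ‖a - P‖ ^ 2 = ‖a‖ ^ 2 - 2 * (inner ℂ a z).re + ‖P‖ ^ 2 := by
    have h := norm_sub_sq (𝕜 := ℂ) a P
    rw [haP] at h
    exact h
  have hden : ‖1 - inner ℂ a z‖ ^ 2 =
      1 - 2 * (inner ℂ a z).re + ‖(inner ℂ a z : ℂ)‖ ^ 2 := by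
    rw [← Complex.normSq_eq_norm_sq, ← Complex.normSq_eq_norm_sq, Complex.normSq_apply,
      Complex.normSq_apply]
    simp
    ring
  have hΦ : ‖ballAut a z‖ ^ 2 =
      ‖a - P - (s : ℂ) • (z - P)‖ ^ 2 / ‖1 - inner ℂ a z‖ ^ 2 := by
    rw [ballAut, norm_smul, norm_inv, mul_pow, inv_pow, div_eq_inv_mul]
  rw [hΦ, eq_div_iff (by positivity), sub_mul, div_mul_cancel₀ _ (by positivity), hN, haP2, hs2]
  have : ‖z - P‖ ^ 2 = ‖z‖ ^ 2 - ‖P‖ ^ 2 := by linarith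
  rw [this, hden, ← hcs]
  ring

lemma norm_ballAut_zero {n : ℕ} (z : Cn n) : ‖ballAut 0 z‖ = ‖z‖ := by
  have : proj (0 : Cn n) z = 0 := by simp [proj]
  simp [ballAut, this]

/-! ### Sums over lacunary sequences -/

lemma IsHadamardGap.mul_le {d : ℕ → ℕ} (hd : IsHadamardGap d) :
    ∃ c : ℝ, 1 < c ∧ ∀ k, c * d k ≤ d (k + 1) := by
  obtain ⟨h0, c, hc, h⟩ := hd
  exact ⟨c, hc, fun k => (le_div_iff₀ (by exact_mod_cast h0 k)).1 (h k)⟩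

/-- The exponential beats every power. -/
lemma rpow_le_rpow_mul_exp {q u : ℝ} (hq : 0 < q) (hu : 0 ≤ u) :
    u ^ q ≤ q ^ q * Real.exp u := by
  have h1 : u / q ≤ Real.exp (u / q) := by linarith [Real.add_one_le_exp (u / q)]
  have h2 : (u / q) ^ q ≤ Real.exp (u / q) ^ q := Real.rpow_le_rpow (by positivity) h1 hq.le
  rw [← Real.exp_mul, div_mul_cancel₀ _ hq.ne', Real.div_rpow hu hq.le,
    div_le_iff₀ (by positivity)] at h2
  linarith

/-- With `φ(u) = u^p / (1 + u^p)`, the term `u^p e^{-u}` is controlled by the increment of the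
bounded function `φ` from `u` to any `v ≥ c u`. -/
lemma rpow_mul_exp_neg_le {p c : ℝ} (hp : 0 < p) (hc : 1 < c) :
    ∃ K : ℝ, 0 ≤ K ∧ ∀ u v : ℝ, 0 ≤ u → c * u ≤ v →
      u ^ p * Real.exp (-u) ≤ K * (v ^ p / (1 + v ^ p) - u ^ p / (1 + u ^ p)) := by
  have hc0 : 0 < c := by linarith
  have hcp : 1 < c ^ p := Real.one_lt_rpow hc hp
  set L : ℝ := 2 + 2 * (2 * p) ^ (2 * p) with hL
  have hL0 : 0 ≤ L := by positivity
  refine ⟨L * c ^ p / (c ^ p - 1), div_nonneg (by positivity) (by linarith), ?_⟩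
  intro u v hu huv
  set x := u ^ p with hx
  have hx0 : 0 ≤ x := Real.rpow_nonneg hu p
  have hv : c ^ p * x ≤ v ^ p := by
    rw [hx, ← Real.mul_rpow hc0.le hu]
    exact Real.rpow_le_rpow (by positivity) huv hp.le
  have hbd : (1 + x) ^ 2 ≤ L * Real.exp u := by
    have h1 : x ^ 2 ≤ (2 * p) ^ (2 * p) * Real.exp u := by
      have h := rpow_le_rpow_mul_exp (q := 2 * p) (by positivity) hu
      have e : u ^ (2 * p) = x ^ 2 := by
        rw [hx, mul_comm, Real.rpow_mul hu]; norm_cast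
      rwa [e] at h
    have h2 : 1 ≤ Real.exp u := Real.one_le_exp hu
    nlinarith [sq_nonneg (1 - x)]
  set q := c ^ p with hq
  have hmono : q * x / (1 + q * x) ≤ v ^ p / (1 + v ^ p) := by
    have : 0 ≤ q * x := by positivity
    rw [div_le_div_iff₀ (by linarith) (by linarith)]
    nlinarith
  have hstep : x * Real.exp (-u) ≤
      L * q / (q - 1) * (q * x / (1 + q * x) - x / (1 + x)) := by
    have hqx : 0 ≤ q * x := by positivity
    have e1 : q * x / (1 + q * x) - x / (1 + x) = (q - 1) * x / ((1 + q * x) * (1 + x)) := by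
      field_simp; ring
    have hq1 : q - 1 ≠ 0 := by linarith
    have e2 : L * q / (q - 1) * ((q - 1) * x / ((1 + q * x) * (1 + x))) =
        L * q * x / ((1 + q * x) * (1 + x)) := by
      field_simp
    rw [e1, e2, Real.exp_neg, ← div_eq_mul_inv,
      div_le_div_iff₀ (Real.exp_pos u) (by positivity)]
    have h3 : (1 + q * x) * (1 + x) ≤ q * (1 + x) ^ 2 := by nlinarith
    calc x * ((1 + q * x) * (1 + x)) ≤ x * (q * (L * Real.exp u)) := by
          have h4 : q * (1 + x) ^ 2 ≤ q * (L * Real.exp u) := by gcongr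
          exact mul_le_mul_of_nonneg_left (h3.trans h4) hx0
      _ = L * q * x * Real.exp u := by ring
  refine hstep.trans ?_
  have : 0 ≤ L * q / (q - 1) := div_nonneg (by positivity) (by linarith)
  gcongr

/-- For a Hadamard gap sequence, `∑ d_j^p r^{d_j} = O((1 - r)^{-p})` as `r → 1`. -/
theorem IsHadamardGap.sum_rpow_mul_pow_le {d : ℕ → ℕ} (hd : IsHadamardGap d) {p : ℝ}
    (hp : 0 < p) :
    ∃ K : ℝ, 0 ≤ K ∧ ∀ r : ℝ, 0 ≤ r → r < 1 → ∀ N : ℕ,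
      (1 - r) ^ p * ∑ j ∈ Finset.range N, (d j : ℝ) ^ p * r ^ d j ≤ K := by
  obtain ⟨c, hc, hgap⟩ := hd.mul_le
  obtain ⟨K, hK, h⟩ := rpow_mul_exp_neg_le hp hc
  refine ⟨K, hK, fun r hr0 hr1 N => ?_⟩
  set x := 1 - r with hx
  have hx0 : 0 < x := by linarith
  let φ : ℕ → ℝ := fun j => (d j * x) ^ p / (1 + (d j * x) ^ p)
  have hterm : ∀ j, x ^ p * ((d j : ℝ) ^ p * r ^ d j) ≤ K * (φ (j + 1) - φ j) := by
    intro j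
    have h1 := h (d j * x) (d (j + 1) * x) (by positivity)
      (by rw [← mul_assoc]; gcongr; exact hgap j)
    refine le_trans ?_ h1
    rw [Real.mul_rpow (by positivity) hx0.le]
    have h2 : r ^ d j ≤ Real.exp (-(d j * x)) := by
      have : r ≤ Real.exp (-x) := by linarith [Real.add_one_le_exp (-x)]
      calc r ^ d j ≤ Real.exp (-x) ^ d j := by gcongr
        _ = _ := by rw [← Real.exp_nat_mul]; ring_nf
    calc x ^ p * ((d j : ℝ) ^ p * r ^ d j) = (d j : ℝ) ^ p * x ^ p * r ^ d j := by ring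
      _ ≤ _ := by gcongr
  calc x ^ p * ∑ j ∈ Finset.range N, (d j : ℝ) ^ p * r ^ d j
      = ∑ j ∈ Finset.range N, x ^ p * ((d j : ℝ) ^ p * r ^ d j) := by rw [Finset.mul_sum]
    _ ≤ ∑ j ∈ Finset.range N, K * (φ (j + 1) - φ j) := Finset.sum_le_sum fun j _ => hterm j
    _ = K * (φ N - φ 0) := by rw [← Finset.mul_sum, Finset.sum_range_sub]
    _ ≤ K * 1 := by
        have h1 : φ N ≤ 1 := by
          have : 0 ≤ (d N * x) ^ p := by positivity
          exact (div_le_one (by positivity)).2 (by linarith)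
        have h2 : 0 ≤ φ 0 := by positivity
        gcongr
        linarith
    _ = K := mul_one K

/-- Cauchy–Schwarz with the weights `d_j^p r^{d_j}` for lacunary sums. -/
theorem IsHadamardGap.sq_sum_mul_pow_le {d : ℕ → ℕ} (hd : IsHadamardGap d) {p : ℝ}
    (hp : 0 < p) :
    ∃ K : ℝ, 0 ≤ K ∧ ∀ r : ℝ, 0 ≤ r → r < 1 → ∀ (b : ℕ → ℝ) (N : ℕ),
      (∑ j ∈ Finset.range N, b j * r ^ d j) ^ 2 * (1 - r) ^ p ≤
        K * ∑ j ∈ Finset.range N, b j ^ 2 * (d j : ℝ) ^ (-p) * r ^ d j := by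
  obtain ⟨K, hK, h⟩ := hd.sum_rpow_mul_pow_le hp
  refine ⟨K, hK, fun r hr0 hr1 b N => ?_⟩
  have hcs := Finset.sum_sq_le_sum_mul_sum_of_sq_le_mul (Finset.range N)
    (r := fun j => b j * r ^ d j) (f := fun j => b j ^ 2 * (d j : ℝ) ^ (-p) * r ^ d j)
    (g := fun j => (d j : ℝ) ^ p * r ^ d j) (fun j _ => by positivity) (fun j _ => by positivity)
    (fun j _ => by
      have hj : (0 : ℝ) < d j := by exact_mod_cast hd.1 j
      have : (d j : ℝ) ^ (-p) * (d j : ℝ) ^ p = 1 := by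
        rw [← Real.rpow_add hj, neg_add_cancel, Real.rpow_zero]
      calc (b j * r ^ d j) ^ 2
          = b j ^ 2 * r ^ d j * r ^ d j * ((d j : ℝ) ^ (-p) * (d j : ℝ) ^ p) := by
            rw [this]; ring
        _ ≤ _ := le_of_eq (by ring))
  have hx : 0 ≤ (1 - r) ^ p := Real.rpow_nonneg (by linarith) p
  have hS : 0 ≤ ∑ j ∈ Finset.range N, b j ^ 2 * (d j : ℝ) ^ (-p) * r ^ d j :=
    Finset.sum_nonneg fun j _ => by positivity
  calc _ ≤ ((∑ j ∈ Finset.range N, b j ^ 2 * (d j : ℝ) ^ (-p) * r ^ d j) *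
        ∑ j ∈ Finset.range N, (d j : ℝ) ^ p * r ^ d j) * (1 - r) ^ p := by gcongr
    _ = ((1 - r) ^ p * ∑ j ∈ Finset.range N, (d j : ℝ) ^ p * r ^ d j) *
        ∑ j ∈ Finset.range N, b j ^ 2 * (d j : ℝ) ^ (-p) * r ^ d j := by ring
    _ ≤ _ := by gcongr; exact h r hr0 hr1 N

/-! ### Polar coordinates in `ℂⁿ` -/

/-- The unnormalized surface measure on the unit sphere of `ℂⁿ`. -/
noncomputable abbrev surfMeasure (n : ℕ) : Measure (unitSphere n) :=
  (volume : Measure (Cn n)).toSphere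

lemma finrank_Cn (n : ℕ) : Module.finrank ℝ (Cn n) = 2 * n := by
  rw [finrank_real_of_complex]; simp

instance nontrivial_Cn {n : ℕ} [NeZero n] : Nontrivial (Cn n) :=
  Module.nontrivial_of_finrank_pos (R := ℂ) (by simpa using NeZero.pos n)

/-- `volumeIoiPow (2n - 1)` is the measure `r^{2n-1} dr` on the half-line. -/
theorem lintegral_polar {n : ℕ} [NeZero n] {h : Cn n → ℝ≥0∞} (hh : Measurable h) :
    ∫⁻ z, h z = ∫⁻ ξ : unitSphere n, ∫⁻ r : Set.Ioi (0 : ℝ), h (r.1 • (ξ : Cn n))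
      ∂(Measure.volumeIoiPow (2 * n - 1)) ∂(surfMeasure n) := by
  have hmp := (volume : Measure (Cn n)).measurePreserving_homeomorphUnitSphereProd
  rw [finrank_Cn] at hmp
  have hm : Measurable fun y : unitSphere n × Set.Ioi (0 : ℝ) => h (y.2.1 • (y.1 : Cn n)) :=
    hh.comp (by fun_prop)
  calc ∫⁻ z, h z = ∫⁻ z in ({0}ᶜ : Set (Cn n)), h z := by rw [restrict_compl_singleton]
    _ = ∫⁻ z : ({0}ᶜ : Set (Cn n)), h z
          ∂(volume.comap (Subtype.val : ({0}ᶜ : Set (Cn n)) → Cn n)) :=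
        (lintegral_subtype_comap (measurableSet_singleton _).compl h).symm
    _ = ∫⁻ z : ({0}ᶜ : Set (Cn n)), (fun y : unitSphere n × Set.Ioi (0 : ℝ) =>
          h (y.2.1 • (y.1 : Cn n))) (homeomorphUnitSphereProd (Cn n) z)
          ∂(volume.comap (Subtype.val : ({0}ᶜ : Set (Cn n)) → Cn n)) := by
        refine lintegral_congr fun z => ?_
        have := homeomorphUnitSphereProd_symm_apply_coe (Cn n) (homeomorphUnitSphereProd (Cn n) z)
        rw [Homeomorph.symm_apply_apply] at this
        simp only [← this]
    _ = _ := by rw [hmp.lintegral_comp hm, lintegral_prod _ hm.aemeasurable]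

theorem lintegral_ball_polar {n : ℕ} [NeZero n] {h : Cn n → ℝ≥0∞} (hh : Measurable h) :
    ∫⁻ z in unitBall n, h z = ∫⁻ r in Set.Ioo (0 : ℝ) 1, ENNReal.ofReal (r ^ (2 * n - 1)) *
      ∫⁻ ξ : unitSphere n, h (r • (ξ : Cn n)) ∂(surfMeasure n) := by
  have hB : MeasurableSet (unitBall n) := Metric.isOpen_ball.measurableSet
  have hm : Measurable fun y : unitSphere n × Set.Ioi (0 : ℝ) =>
      (unitBall n).indicator h (y.2.1 • (y.1 : Cn n)) := (hh.indicator hB).comp (by fun_prop)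
  have hm2 : Measurable fun y : ℝ × unitSphere n => h (y.1 • (y.2 : Cn n)) :=
    hh.comp (by fun_prop)
  have hm3 : Measurable fun r : ℝ => ENNReal.ofReal (r ^ (2 * n - 1)) *
      ∫⁻ ξ : unitSphere n, h (r • (ξ : Cn n)) ∂(surfMeasure n) :=
    Measurable.mul (by fun_prop) hm2.lintegral_prod_right'
  rw [← lintegral_indicator hB, lintegral_polar (hh.indicator hB), lintegral_lintegral_swap
    hm.aemeasurable, Measure.volumeIoiPow, lintegral_withDensity_eq_lintegral_mul _ (by fun_prop)
    (hm.lintegral_prod_left')]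
  have key : ∀ r : Set.Ioi (0 : ℝ), ((fun r : Set.Ioi (0 : ℝ) =>
      ENNReal.ofReal (r.1 ^ (2 * n - 1))) * fun r : Set.Ioi (0 : ℝ) =>
        ∫⁻ ξ : unitSphere n, (unitBall n).indicator h (r.1 • (ξ : Cn n)) ∂(surfMeasure n)) r =
      (Set.Iio (1 : ℝ)).indicator (fun r : ℝ => ENNReal.ofReal (r ^ (2 * n - 1)) *
        ∫⁻ ξ : unitSphere n, h (r • (ξ : Cn n)) ∂(surfMeasure n)) r := by
    intro r
    have hr : (0 : ℝ) < r := r.2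
    have hmem : ∀ ξ : unitSphere n, r.1 • (ξ : Cn n) ∈ unitBall n ↔ r.1 < 1 := by
      intro ξ
      simp [unitBall, norm_smul, abs_of_pos hr]
    by_cases h1 : r.1 < 1 <;> simp [Set.indicator, hmem, h1]
  rw [lintegral_congr key, lintegral_subtype_comap measurableSet_Ioi
    ((Set.Iio (1 : ℝ)).indicator (fun r : ℝ => ENNReal.ofReal (r ^ (2 * n - 1)) *
        ∫⁻ ξ : unitSphere n, h (r • (ξ : Cn n)) ∂(surfMeasure n))),
    lintegral_indicator measurableSet_Iio, Measure.restrict_restrict measurableSet_Iio,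
    Set.inter_comm, Set.Ioi_inter_Iio]

/-! ### Integrals of the Poisson–Szegő kernel -/

/-- Volumes of coordinate boxes in `ℂⁿ`, up to a normalizing constant. -/
lemma exists_volume_box (n : ℕ) : ∃ c : ℝ≥0∞, c ≠ ∞ ∧ ∀ S : Fin n → Set ℂ,
    (∀ i, MeasurableSet (S i)) →
      volume {z : Cn n | ∀ i, z i ∈ S i} = c * ∏ i, volume (S i) := by
  let e := PiLp.continuousLinearEquiv 2 ℝ (fun _ : Fin n => ℂ)
  have : (Measure.map e (volume : Measure (Cn n))).IsAddHaarMeasure :=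
    e.isAddHaarMeasure_map volume
  have h := Measure.isAddLeftInvariant_eq_smul (Measure.map e (volume : Measure (Cn n))) volume
  refine ⟨(Measure.map e (volume : Measure (Cn n))).addHaarScalarFactor volume,
    ENNReal.coe_ne_top, fun S hS => ?_⟩
  have h1 := congrArg (fun μ : Measure (Fin n → ℂ) => μ (Set.univ.pi S)) h
  simp only [Measure.smul_apply, volume_pi_pi] at h1
  rw [Measure.map_apply e.continuous.measurable (MeasurableSet.univ_pi hS)] at h1
  have h2 : (e ⁻¹' Set.univ.pi S : Set (Cn n)) = {z : Cn n | ∀ i, z i ∈ S i} := by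
    ext z; simp [e]
  rw [h2] at h1
  rw [h1]
  rfl

lemma volume_complex_rect (l u l' u' : ℝ) :
    volume {w : ℂ | w.re ∈ Set.Icc l u ∧ w.im ∈ Set.Icc l' u'} =
      ENNReal.ofReal (u - l) * ENNReal.ofReal (u' - l') := by
  have h := Complex.volume_preserving_equiv_real_prod.measure_preimage
    (s := Set.Icc l u ×ˢ Set.Icc l' u')
    ((measurableSet_Icc.prod measurableSet_Icc).nullMeasurableSet)
  rw [Measure.volume_eq_prod, Measure.prod_prod, Real.volume_Icc, Real.volume_Icc] at h
  exact h

/-- Completing the square: if `w` is a coordinate of a vector of norm `N`, `t` is the modulus of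
another coordinate (or `0`), and `|N - s w| < 1`, then `w` and `t` lie in a box whose sides are
controlled by `1 - s²`. -/
lemma box_of_norm_sub_lt {s N : ℝ} {w : ℂ} {t : ℝ} (hs0 : 0 ≤ s) (hs1 : s < 1) (hN : 0 ≤ N)
    (hw : ‖w‖ ^ 2 + t ^ 2 ≤ N ^ 2) (h : ‖(N : ℂ) - s * w‖ < 1) :
    |(1 - s ^ 2) * w.re - s| ≤ 1 ∧ |w.im| ≤ 2 ∧ (1 - s ^ 2) * t ^ 2 ≤ 1 := by
  have hw2 : ‖w‖ ^ 2 = w.re ^ 2 + w.im ^ 2 := by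
    rw [← Complex.normSq_eq_norm_sq, Complex.normSq_apply]; ring
  have hre : |N - s * w.re| < 1 := by
    have := (Complex.abs_re_le_norm ((N : ℂ) - s * w)).trans_lt h
    simpa using this
  have him : |s * w.im| < 1 := by
    have := (Complex.abs_im_le_norm ((N : ℂ) - s * w)).trans_lt h
    simpa using this
  have h1 : N ≤ 1 + s * w.re := by linarith [(abs_lt.1 hre).2]
  have h2 : N ^ 2 ≤ (1 + s * w.re) ^ 2 := by gcongr
  have hs2 : 0 < 1 - s ^ 2 := by nlinarith
  have key : ((1 - s ^ 2) * w.re - s) ^ 2 + (1 - s ^ 2) * t ^ 2 ≤ 1 := by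
    have h3 : (1 - s ^ 2) * (w.re ^ 2 + t ^ 2) ≤ (1 - s ^ 2) * (1 + s * w.re) ^ 2 := by
      gcongr
      nlinarith [sq_nonneg w.im]
    have h4 : (1 - s ^ 2) * (w.re ^ 2 + t ^ 2 - (1 + s * w.re) ^ 2) ≤ 0 := by nlinarith
    nlinarith [sq_nonneg w.im]
  refine ⟨?_, ?_, ?_⟩
  · rw [← sq_le_one_iff_abs_le_one]
    nlinarith [mul_nonneg hs2.le (sq_nonneg t)]
  · by_cases hs : 1 / 2 ≤ s
    · rw [abs_mul, abs_of_nonneg hs0] at him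
      nlinarith [abs_nonneg w.im]
    · -- for small `s` the vector itself is bounded
      have hwN : ‖w‖ ≤ N := by
        refine (sq_le_sq₀ (norm_nonneg _) hN).1 ?_
        nlinarith [sq_nonneg t]
      have h3 : w.re ≤ N := (Complex.re_le_norm w).trans hwN
      have h4 : |w.im| ≤ N := (Complex.abs_im_le_norm w).trans hwN
      push Not at hs
      nlinarith
  · nlinarith [sq_nonneg ((1 - s ^ 2) * w.re - s)]

/-- The homogeneous sublevel set `{z : ||z| - ⟨z, b⟩| < 1}`, which is contained in a box elongated
in the direction of `b`, has volume `O((1 - |b|²)^{-n})`. -/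
theorem exists_volume_sublevel_le (n : ℕ) [NeZero n] : ∃ C : ℝ≥0∞, C ≠ ∞ ∧ ∀ b : Cn n, ‖b‖ < 1 →
    volume {z : Cn n | ‖((‖z‖ : ℝ) : ℂ) - inner ℂ b z‖ < 1} ≤
      C * ENNReal.ofReal ((1 - ‖b‖ ^ 2)⁻¹ ^ n) := by
  obtain ⟨c, hc, hvol⟩ := exists_volume_box n
  refine ⟨c * (ENNReal.ofReal 8 * ENNReal.ofReal Real.pi ^ (n - 1)),
    ENNReal.mul_ne_top hc (by finiteness), fun b hb => ?_⟩
  set s := ‖b‖ with hs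
  have hs0 : 0 ≤ s := norm_nonneg b
  set A : ℝ := (1 - s ^ 2)⁻¹ with hA
  have hs2 : 0 < 1 - s ^ 2 := by nlinarith
  have hA0 : 0 < A := inv_pos.2 hs2
  let i₀ : Fin n := 0
  -- an orthonormal basis whose first vector points in the direction of `b`
  obtain ⟨e, he⟩ : ∃ e : OrthonormalBasis (Fin n) ℂ (Cn n), b = (s : ℂ) • e i₀ := by
    by_cases hb0 : b = 0
    · refine ⟨EuclideanSpace.basisFun (Fin n) ℂ, ?_⟩
      simp [hs, hb0]
    · have hs' : (s : ℂ) ≠ 0 := by simpa [hs] using hb0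
      have hunit : ‖(s : ℂ)⁻¹ • b‖ = 1 := by
        rw [norm_smul, norm_inv, Complex.norm_real, norm_norm, inv_mul_cancel₀]
        simpa using hb0
      have hon : Orthonormal ℂ (({i₀} : Set (Fin n)).domRestrict fun _ => (s : ℂ)⁻¹ • b) :=
        ⟨fun _ => hunit, fun i j hij => absurd (Subsingleton.elim i j) hij⟩
      obtain ⟨e, he⟩ := hon.exists_orthonormalBasis_extension_of_card_eq (by simp)
      refine ⟨e, ?_⟩
      rw [he i₀ rfl, smul_smul, mul_inv_cancel₀ hs', one_smul]
  let S : Fin n → Set ℂ := fun i =>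
    if i = i₀ then {w : ℂ | w.re ∈ Set.Icc (s * A - A) (s * A + A) ∧ w.im ∈ Set.Icc (-2 : ℝ) 2}
    else Metric.closedBall 0 (Real.sqrt A)
  have hS : ∀ i, MeasurableSet (S i) := by
    intro i
    by_cases hi : i = i₀
    · simp only [S, hi, if_true]
      exact (Complex.measurable_re measurableSet_Icc).inter
        (Complex.measurable_im measurableSet_Icc)
    · simp only [S, hi, if_false]
      exact Metric.isClosed_closedBall.measurableSet
  have hmp : MeasurePreserving e.repr (volume : Measure (Cn n)) volume :=
    LinearIsometryEquiv.measurePreserving (E := Cn n) (F := Cn n)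
      { e.repr.toLinearEquiv.restrictScalars ℝ with norm_map' := e.repr.norm_map }
  have hsub : {z : Cn n | ‖((‖z‖ : ℝ) : ℂ) - inner ℂ b z‖ < 1} ⊆
      e.repr ⁻¹' {w : Cn n | ∀ i, w i ∈ S i} := by
    intro z hz i
    have hsum : ∑ i, ‖e.repr z i‖ ^ 2 = ‖z‖ ^ 2 := by
      rw [← EuclideanSpace.norm_sq_eq, e.repr.norm_map]
    have hz' : ‖((‖z‖ : ℝ) : ℂ) - s * e.repr z i₀‖ < 1 := by
      rw [e.repr_apply_apply]
      have := hz
      rw [Set.mem_ofPred_eq, he, inner_smul_left, Complex.conj_ofReal] at this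
      exact this
    by_cases hi : i = i₀
    · subst hi
      have hle : ‖e.repr z i₀‖ ^ 2 + (0 : ℝ) ^ 2 ≤ ‖z‖ ^ 2 := by
        rw [← hsum]
        simpa using Finset.single_le_sum (f := fun i => ‖e.repr z i‖ ^ 2)
          (fun _ _ => by positivity) (Finset.mem_univ i₀)
      obtain ⟨h1, h2, -⟩ := box_of_norm_sub_lt hs0 hb (norm_nonneg z) hle hz'
      simp only [S, if_true]
      have h3 : (e.repr z i₀).re = A * ((1 - s ^ 2) * (e.repr z i₀).re) := by
        rw [← mul_assoc, hA, inv_mul_cancel₀ hs2.ne', one_mul]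
      rw [abs_le] at h1
      refine ⟨⟨?_, ?_⟩, abs_le.1 h2⟩ <;> rw [h3] <;> nlinarith
    · have hle : ‖e.repr z i₀‖ ^ 2 + ‖e.repr z i‖ ^ 2 ≤ ‖z‖ ^ 2 := by
        rw [← hsum, ← Finset.sum_pair (f := fun i => ‖e.repr z i‖ ^ 2) (Ne.symm hi)]
        exact Finset.sum_le_sum_of_subset_of_nonneg (Finset.subset_univ _)
          fun _ _ _ => by positivity
      obtain ⟨-, -, h3⟩ := box_of_norm_sub_lt hs0 hb (norm_nonneg z) hle hz'
      simp only [S, hi, if_false, mem_closedBall_zero_iff]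
      refine Real.le_sqrt_of_sq_le ?_
      rw [hA, ← one_div, le_div_iff₀ hs2]
      linarith
  calc volume {z : Cn n | ‖((‖z‖ : ℝ) : ℂ) - inner ℂ b z‖ < 1}
      ≤ volume (e.repr ⁻¹' {w : Cn n | ∀ i, w i ∈ S i}) := measure_mono hsub
    _ = volume {w : Cn n | ∀ i, w i ∈ S i} := by
        refine hmp.measure_preimage (MeasurableSet.nullMeasurableSet ?_)
        rw [Set.ofPred_forall]
        exact MeasurableSet.iInter fun i => (by fun_prop : Measurable fun w : Cn n => w i) (hS i)
    _ = c * ∏ i, volume (S i) := hvol S hS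
    _ = c * (ENNReal.ofReal 8 * ENNReal.ofReal Real.pi ^ (n - 1)) * ENNReal.ofReal (A ^ n) := by
        rw [← Finset.mul_prod_erase _ _ (Finset.mem_univ i₀)]
        have h1 : volume (S i₀) = ENNReal.ofReal 8 * ENNReal.ofReal A := by
          simp only [S, if_true]
          rw [volume_complex_rect, ← ENNReal.ofReal_mul (by linarith),
            ← ENNReal.ofReal_mul (by norm_num)]
          congr 1; ring
        have h2 : ∏ i ∈ Finset.univ.erase i₀, volume (S i) =
            (ENNReal.ofReal Real.pi * ENNReal.ofReal A) ^ (n - 1) := by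
          rw [Finset.prod_congr rfl (g := fun _ => ENNReal.ofReal Real.pi * ENNReal.ofReal A)]
          · simp
          · intro i hi
            simp only [S, (Finset.mem_erase.1 hi).1, if_false]
            rw [Complex.volume_closedBall, ← ENNReal.ofReal_pow (Real.sqrt_nonneg A),
              Real.sq_sqrt hA0.le, mul_comm]
            congr 1
            rw [← NNReal.coe_real_pi, ENNReal.ofReal_coe_nnreal]
        have hn : n - 1 + 1 = n := Nat.sub_add_cancel (NeZero.one_le)
        rw [h1, h2, mul_pow, ENNReal.ofReal_pow hA0.le]
        nth_rewrite 4 [← hn]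
        rw [pow_succ]
        ring

/-- The surface integral of `|1 - ⟨ξ, b⟩|^{-2n}` is the volume of a sublevel set, up to the factor
`2n` from integrating `r^{2n-1}` along rays. -/
theorem exists_lintegral_kernel_le (n : ℕ) [NeZero n] : ∃ C : ℝ≥0∞, C ≠ ∞ ∧
    ∀ b : Cn n, ‖b‖ < 1 →
      ∫⁻ ξ : unitSphere n, ENNReal.ofReal ((‖1 - inner ℂ b (ξ : Cn n)‖⁻¹ ^ 2) ^ n)
        ∂(surfMeasure n) ≤ C * ENNReal.ofReal ((1 - ‖b‖ ^ 2)⁻¹ ^ n) := by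
  obtain ⟨C, hC, hvol⟩ := exists_volume_sublevel_le n
  refine ⟨ENNReal.ofReal (2 * n) * C, by finiteness, fun b hb => ?_⟩
  set E : Set (Cn n) := {z : Cn n | ‖((‖z‖ : ℝ) : ℂ) - inner ℂ b z‖ < 1} with hE
  have hEm : MeasurableSet E := by
    refine (isOpen_lt ?_ continuous_const).measurableSet
    fun_prop
  have hn : (0 : ℝ) < n := by exact_mod_cast NeZero.pos n
  have hn2 : 2 * n - 1 + 1 = 2 * n := by have := NeZero.pos n; omega
  have hpolar := lintegral_polar (measurable_one.indicator hEm : Measurable (E.indicator 1))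
  rw [lintegral_indicator_one hEm] at hpolar
  have hinner : ∀ ξ : unitSphere n, ENNReal.ofReal ((‖1 - inner ℂ b (ξ : Cn n)‖⁻¹ ^ 2) ^ n) =
      ENNReal.ofReal (2 * n) * ∫⁻ r : Set.Ioi (0 : ℝ), E.indicator 1 (r.1 • (ξ : Cn n))
        ∂(Measure.volumeIoiPow (2 * n - 1)) := by
    intro ξ
    have hξ : ‖(ξ : Cn n)‖ = 1 := by simp
    have hg : 0 < ‖1 - inner ℂ b (ξ : Cn n)‖ := norm_one_sub_inner_pos hb hξ.le
    set g := ‖1 - inner ℂ b (ξ : Cn n)‖ with hgdef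
    let R : Set.Ioi (0 : ℝ) := ⟨g⁻¹, inv_pos.2 hg⟩
    have hind : ∀ r : Set.Ioi (0 : ℝ), E.indicator (1 : Cn n → ℝ≥0∞) (r.1 • (ξ : Cn n)) =
        (Set.Iio R).indicator 1 r := by
      intro r
      have hr : (0 : ℝ) < r := r.2
      have : r.1 • (ξ : Cn n) ∈ E ↔ r ∈ Set.Iio R := by
        rw [hE, Set.mem_ofPred_eq, norm_smul, hξ, mul_one, Real.norm_of_nonneg hr.le,
          ← Complex.coe_smul, inner_smul_right]
        have : (r.1 : ℂ) - r.1 * inner ℂ b (ξ : Cn n) = r.1 * (1 - inner ℂ b (ξ : Cn n)) := by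
          ring
        rw [this, norm_mul, Complex.norm_real, Real.norm_of_nonneg hr.le, ← hgdef, Set.mem_Iio,
          ← Subtype.coe_lt_coe, ← lt_div_iff₀ hg, one_div]
      simp only [Set.indicator, this]
      rfl
    rw [lintegral_congr hind, lintegral_indicator_one measurableSet_Iio,
      Measure.volumeIoiPow_apply_Iio, hn2, ← ENNReal.ofReal_mul (by positivity)]
    congr 1
    have : ((2 * n - 1 : ℕ) : ℝ) + 1 = 2 * n := by exact_mod_cast hn2
    rw [this, ← pow_mul]
    change _ = 2 * (n : ℝ) * (g⁻¹ ^ (2 * n) / (2 * n))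
    field_simp
  rw [lintegral_congr hinner, lintegral_const_mul' _ _ ENNReal.ofReal_ne_top, ← hpolar, mul_assoc]
  gcongr
  exact hvol b hb

/-- The kernel `((1 - |a|²) / |1 - ⟨z, a⟩|²)^p`; it is the factor of `(1 - |Φ_a(z)|²)^p` which is
not radial in `z`. -/
noncomputable def szegoKernel {n : ℕ} (p : ℝ) (a z : Cn n) : ℝ≥0∞ :=
  ENNReal.ofReal (((1 - ‖a‖ ^ 2) / ‖1 - inner ℂ a z‖ ^ 2) ^ p)

lemma measurable_szegoKernel {n : ℕ} (p : ℝ) (a : Cn n) : Measurable (szegoKernel p a) := by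
  unfold szegoKernel
  have h : Continuous fun z : Cn n => ‖1 - inner ℂ a z‖ ^ 2 := by fun_prop
  exact ((h.measurable.const_div _).pow_const p).ennreal_ofReal

lemma inner_real_smul_left_eq {n : ℕ} (r : ℝ) (a z : Cn n) :
    inner ℂ (r • a) z = inner ℂ a (r • z) := by
  rw [← Complex.coe_smul, ← Complex.coe_smul, inner_smul_left, inner_smul_right,
    Complex.conj_ofReal]

/-- Here the hypothesis `p ≤ n` enters: for `p = n` this is the Poisson–Szegő kernel, whose
surface integrals are bounded, and `x^p ≤ 1 + x^n` covers the smaller exponents. -/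
theorem exists_lintegral_szegoKernel_le {n : ℕ} [NeZero n] {p : ℝ} (hp : 0 < p)
    (hpn : p ≤ (n : ℝ)) : ∃ C : ℝ≥0∞, C ≠ ∞ ∧ ∀ a : Cn n, ‖a‖ < 1 → ∀ r : ℝ, 0 ≤ r → r < 1 →
      ∫⁻ ξ : unitSphere n, szegoKernel p a (r • (ξ : Cn n)) ∂(surfMeasure n) ≤ C := by
  obtain ⟨C, hC, hker⟩ := exists_lintegral_kernel_le n
  refine ⟨surfMeasure n Set.univ + C, ENNReal.add_ne_top.2 ⟨measure_ne_top _ _, hC⟩,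
    fun a ha r hr0 hr1 => ?_⟩
  have ha2 := one_sub_norm_sq_pos ha
  have hra : ‖r • a‖ ≤ ‖a‖ := by
    rw [norm_smul, Real.norm_of_nonneg hr0]
    exact mul_le_of_le_one_left (norm_nonneg a) hr1.le
  have hpt : ∀ ξ : unitSphere n, szegoKernel p a (r • (ξ : Cn n)) ≤
      1 + ENNReal.ofReal ((1 - ‖a‖ ^ 2) ^ n) *
        ENNReal.ofReal ((‖1 - inner ℂ (r • a) (ξ : Cn n)‖⁻¹ ^ 2) ^ n) := by
    intro ξ
    rw [inner_real_smul_left_eq, ← ENNReal.ofReal_mul (by positivity), ← mul_pow, inv_pow,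
      ← div_eq_mul_inv, ← ENNReal.ofReal_one, ← ENNReal.ofReal_add zero_le_one (by positivity)]
    refine ENNReal.ofReal_le_ofReal ?_
    set x := (1 - ‖a‖ ^ 2) / ‖1 - inner ℂ a (r • (ξ : Cn n))‖ ^ 2 with hx
    have hx0 : 0 ≤ x := by positivity
    rcases le_total x 1 with h | h
    · have := Real.rpow_le_one hx0 h hp.le
      have : 0 ≤ x ^ n := by positivity
      linarith
    · have := Real.rpow_le_rpow_of_exponent_le h hpn
      rw [Real.rpow_natCast] at this
      linarith
  calc ∫⁻ ξ : unitSphere n, szegoKernel p a (r • (ξ : Cn n)) ∂(surfMeasure n)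
      ≤ ∫⁻ ξ : unitSphere n, (1 + ENNReal.ofReal ((1 - ‖a‖ ^ 2) ^ n) *
        ENNReal.ofReal ((‖1 - inner ℂ (r • a) (ξ : Cn n)‖⁻¹ ^ 2) ^ n)) ∂(surfMeasure n) :=
        lintegral_mono hpt
    _ = surfMeasure n Set.univ + ENNReal.ofReal ((1 - ‖a‖ ^ 2) ^ n) *
        ∫⁻ ξ : unitSphere n, ENNReal.ofReal ((‖1 - inner ℂ (r • a) (ξ : Cn n)‖⁻¹ ^ 2) ^ n)
          ∂(surfMeasure n) := by
        rw [lintegral_add_left measurable_const, lintegral_one,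
          lintegral_const_mul' _ _ ENNReal.ofReal_ne_top]
    _ ≤ surfMeasure n Set.univ + ENNReal.ofReal ((1 - ‖a‖ ^ 2) ^ n) *
        (C * ENNReal.ofReal ((1 - ‖a‖ ^ 2)⁻¹ ^ n)) := by
        gcongr
        refine (hker (r • a) (hra.trans_lt ha)).trans ?_
        have := one_sub_norm_sq_pos (hra.trans_lt ha)
        gcongr
    _ = surfMeasure n Set.univ + C := by
        rw [mul_left_comm, ← ENNReal.ofReal_mul (by positivity), ← mul_pow,
          mul_inv_cancel₀ ha2.ne', one_pow, ENNReal.ofReal_one, mul_one]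

/-- On a fixed sphere of radius `r < 1` the kernel tends uniformly to zero at the boundary. -/
lemma szegoKernel_le {n : ℕ} {p : ℝ} (hp : 0 < p) {a z : Cn n} (ha : ‖a‖ < 1) (hz : ‖z‖ < 1) :
    szegoKernel p a z ≤ ENNReal.ofReal (((1 - ‖a‖ ^ 2) / (1 - ‖z‖) ^ 2) ^ p) := by
  have ha2 := one_sub_norm_sq_pos ha
  have h1 : 1 - ‖z‖ ≤ ‖1 - inner ℂ a z‖ := by
    have h1 : ‖inner ℂ a z‖ ≤ ‖a‖ * ‖z‖ := norm_inner_le_norm a z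
    have h2 : ‖a‖ * ‖z‖ ≤ ‖z‖ := mul_le_of_le_one_left (norm_nonneg z) ha.le
    have h3 := norm_sub_norm_le (1 : ℂ) (inner ℂ a z)
    rw [norm_one] at h3
    linarith
  have h2 : 0 < 1 - ‖z‖ := by linarith
  unfold szegoKernel
  gcongr

/-! ### The coefficient condition -/

/-- The sum `∑_j |a_j|² d_j^{-(1+p)}`, which replaces each dyadic weight `2^{-k(1+p)}` by the
comparable `d_j^{-(1+p)}`. Its values are in `[0, ∞]`. -/
noncomputable def weightedSum (p : ℝ) (d : ℕ → ℕ) (a : ℕ → ℂ) : ℝ≥0∞ :=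
  ∑' j, ENNReal.ofReal (‖a j‖ ^ 2 * (d j : ℝ) ^ (-(1 + p)))

/-- Each `j` lies in exactly one dyadic block, the one of index `⌊log₂ d_j⌋`. -/
lemma dyadicSum_eq {p : ℝ} {d : ℕ → ℕ} (hd : ∀ j, 0 < d j) (a : ℕ → ℂ) :
    dyadicSum p d a = ∑' j, ENNReal.ofReal (1 / 2 ^ ((Nat.log 2 (d j) : ℝ) * (1 + p))) *
      ENNReal.ofReal (‖a j‖ ^ 2) := by
  have h : ∀ k j, (2 ^ k ≤ d j ∧ d j < 2 ^ (k + 1)) ↔ k = Nat.log 2 (d j) := by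
    intro k j
    rw [eq_comm, Nat.log_eq_iff (Or.inr ⟨one_lt_two, (hd j).ne'⟩)]
  have hk : ∀ k, ∑' j : {j : ℕ // 2 ^ k ≤ d j ∧ d j < 2 ^ (k + 1)},
      ENNReal.ofReal (‖a j‖ ^ 2) =
        ∑' j, if k = Nat.log 2 (d j) then ENNReal.ofReal (‖a j‖ ^ 2) else 0 := by
    intro k
    have := tsum_subtype {j : ℕ | 2 ^ k ≤ d j ∧ d j < 2 ^ (k + 1)}
      fun j => ENNReal.ofReal (‖a j‖ ^ 2)
    refine this.trans (tsum_congr fun j => ?_)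
    by_cases hj : k = Nat.log 2 (d j) <;> simp only [Set.indicator, Set.mem_ofPred_eq, h, hj]
  unfold dyadicSum
  simp_rw [hk, ← ENNReal.tsum_mul_left]
  rw [ENNReal.tsum_comm]
  refine tsum_congr fun j => ?_
  rw [tsum_eq_single (Nat.log 2 (d j)) fun k hkj => by simp [hkj]]
  simp

lemma weightedSum_le_dyadicSum {p : ℝ} (hp : 0 < p) {d : ℕ → ℕ} (hd : ∀ j, 0 < d j)
    (a : ℕ → ℂ) : weightedSum p d a ≤ dyadicSum p d a := by
  rw [dyadicSum_eq hd]
  refine ENNReal.tsum_le_tsum fun j => ?_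
  rw [← ENNReal.ofReal_mul (by positivity), mul_comm]
  refine ENNReal.ofReal_le_ofReal ?_
  gcongr
  have hj : (0 : ℝ) < d j := by exact_mod_cast hd j
  rw [Real.rpow_neg hj.le, ← one_div, Real.rpow_mul zero_le_two, Real.rpow_natCast]
  gcongr
  exact_mod_cast Nat.pow_log_le_self 2 (hd j).ne'

lemma dyadicSum_le_weightedSum {p : ℝ} (hp : 0 < p) {d : ℕ → ℕ} (hd : ∀ j, 0 < d j)
    (a : ℕ → ℂ) : dyadicSum p d a ≤ ENNReal.ofReal (2 ^ (1 + p)) * weightedSum p d a := by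
  rw [dyadicSum_eq hd, weightedSum, ← ENNReal.tsum_mul_left]
  refine ENNReal.tsum_le_tsum fun j => ?_
  rw [← ENNReal.ofReal_mul (by positivity), ← ENNReal.ofReal_mul (by positivity), mul_left_comm,
    mul_comm]
  refine ENNReal.ofReal_le_ofReal ?_
  gcongr
  have hj : (0 : ℝ) < d j := by exact_mod_cast hd j
  have h1 : (d j : ℝ) ≤ 2 * 2 ^ Nat.log 2 (d j) := by
    have := (Nat.lt_pow_succ_log_self one_lt_two (d j)).le
    rw [pow_succ'] at this
    exact_mod_cast this
  rw [Real.rpow_neg hj.le, Real.rpow_mul zero_le_two, Real.rpow_natCast, ← div_eq_mul_inv,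
    div_le_div_iff₀ (by positivity) (by positivity), one_mul,
    ← Real.mul_rpow (by positivity) (by positivity)]
  gcongr

/-! ### From the coefficients to the function -/

lemma polyEval_smul {n k : ℕ} {P : MvPolynomial (Fin n) ℂ} (hP : P.IsHomogeneous k) (c : ℂ)
    (z : Cn n) : polyEval P (c • z) = c ^ k * polyEval P z := by
  simp only [polyEval, MvPolynomial.eval_eq', Finset.mul_sum]
  refine Finset.sum_congr rfl fun m hm => ?_
  have hk : ∑ i, m i = k := by
    rw [← hP (MvPolynomial.mem_support_iff.1 hm), Finsupp.weight_apply,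
      Finsupp.sum_fintype _ _ (by simp)]
    simp
  simp only [PiLp.smul_apply, smul_eq_mul, mul_pow, Finset.prod_mul_distrib,
    Finset.prod_pow_eq_pow_sum, hk]
  ring

lemma continuous_polyEval {n : ℕ} (P : MvPolynomial (Fin n) ℂ) : Continuous (polyEval P) :=
  (MvPolynomial.continuous_eval P).comp (by fun_prop)

lemma norm_polyEval_le {n : ℕ} {T : ℕ → MvPolynomial (Fin n) ℂ} (hT : IsRyllWojtaszczyk T)
    (k : ℕ) (z : Cn n) (hz : z ≠ 0) : ‖polyEval (T k) z‖ ≤ ‖z‖ ^ k := by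
  have hz0 : (‖z‖ : ℂ) ≠ 0 := by simpa using hz
  let ξ : unitSphere n := ⟨(‖z‖ : ℂ)⁻¹ • z, by
    rw [mem_sphere_zero_iff_norm, norm_smul, norm_inv, Complex.norm_real, norm_norm,
      inv_mul_cancel₀ (by simpa using hz)]⟩
  have h1 : ‖polyEval (T k) ξ‖ ≤ 1 := (hT.sup_eq_one k).1 ⟨ξ, rfl⟩
  have h2 : z = (‖z‖ : ℂ) • (ξ : Cn n) := by
    simp only [ξ, smul_smul, mul_inv_cancel₀ hz0, one_smul]
  calc ‖polyEval (T k) z‖ = ‖z‖ ^ k * ‖polyEval (T k) ξ‖ := by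
        conv_lhs => rw [h2, polyEval_smul (hT.homogeneous k)]
        simp
    _ ≤ ‖z‖ ^ k := mul_le_of_le_one_right (by positivity) h1

/-- The function `∑_j |a_j|² d_j^{-p} r^{d_j}` with values in `[0, ∞]`; up to a constant it
dominates `|f(z)|² (1 - |z|²)^p` for `|z| = r`. -/
noncomputable def radialMajorant (p : ℝ) (d : ℕ → ℕ) (a : ℕ → ℂ) (r : ℝ) : ℝ≥0∞ :=
  ∑' j, ENNReal.ofReal (‖a j‖ ^ 2 * (d j : ℝ) ^ (-p) * r ^ d j)

lemma measurable_radialMajorant (p : ℝ) (d : ℕ → ℕ) (a : ℕ → ℂ) :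
    Measurable (radialMajorant p d a) :=
  Measurable.tsum fun j => by fun_prop

lemma lintegral_Ioo_pow (k : ℕ) :
    ∫⁻ r in Set.Ioo (0 : ℝ) 1, ENNReal.ofReal (r ^ k) = ENNReal.ofReal (1 / (k + 1)) := by
  rw [Measure.restrict_congr_set Ioo_ae_eq_Ioc,
    ← ofReal_integral_eq_lintegral_ofReal (intervalIntegral.intervalIntegrable_pow _).1,
    ← intervalIntegral.integral_of_le zero_le_one]
  · simp
  · filter_upwards [ae_restrict_mem measurableSet_Ioc] with y hy
    exact pow_nonneg hy.1.le _

lemma lintegral_radialMajorant_le {p : ℝ} {d : ℕ → ℕ} (hd : ∀ j, 0 < d j) (a : ℕ → ℂ) :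
    ∫⁻ r in Set.Ioo (0 : ℝ) 1, radialMajorant p d a r ≤ weightedSum p d a := by
  unfold radialMajorant
  rw [lintegral_tsum fun j => by fun_prop]
  refine ENNReal.tsum_le_tsum fun j => ?_
  have hj : (0 : ℝ) < d j := by exact_mod_cast hd j
  have h0 : 0 ≤ ‖a j‖ ^ 2 * (d j : ℝ) ^ (-p) := by positivity
  simp_rw [ENNReal.ofReal_mul h0]
  rw [lintegral_const_mul' _ _ ENNReal.ofReal_ne_top, lintegral_Ioo_pow,
    ← ENNReal.ofReal_mul h0, mul_assoc]
  refine ENNReal.ofReal_le_ofReal ?_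
  gcongr
  have : (d j : ℝ) ^ (-(1 + p)) = (d j : ℝ) ^ (-p) * (1 / d j) := by
    rw [neg_add_rev, Real.rpow_add hj, Real.rpow_neg_one, one_div]
  rw [this]
  gcongr
  linarith

/-- The origin is left out because the bound `|T_k(z)| ≤ |z|^k` is obtained by normalizing `z`. -/
theorem exists_norm_sq_mul_le_radialMajorant {n : ℕ} {p : ℝ} (hp : 0 < p)
    {T : ℕ → MvPolynomial (Fin n) ℂ} (hT : IsRyllWojtaszczyk T) {d : ℕ → ℕ}
    (hd : IsHadamardGap d) {a : ℕ → ℂ} {f : Cn n → ℂ}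
    (hsum : ∀ z ∈ unitBall n, HasSum (fun k => a k * polyEval (T (d k)) z) (f z)) :
    ∃ C : ℝ≥0∞, C ≠ ∞ ∧ ∀ z : Cn n, z ≠ 0 → ‖z‖ < 1 →
      ENNReal.ofReal (‖f z‖ ^ 2 * (1 - ‖z‖ ^ 2) ^ p) ≤ C * radialMajorant p d a ‖z‖ := by
  obtain ⟨K, hK, hcs⟩ := hd.sq_sum_mul_pow_le hp
  refine ⟨ENNReal.ofReal (2 ^ p * K), ENNReal.ofReal_ne_top, fun z hz0 hz => ?_⟩
  have hlim := (hsum z (by simpa [unitBall] using hz)).tendsto_sum_nat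
  have hlim2 := ENNReal.tendsto_ofReal ((hlim.norm.pow 2).mul_const ((1 - ‖z‖ ^ 2) ^ p))
  refine le_of_tendsto' hlim2 fun N => ?_
  set r := ‖z‖ with hr
  have hr0 : 0 ≤ r := norm_nonneg z
  have h1 : ‖∑ j ∈ Finset.range N, a j * polyEval (T (d j)) z‖ ≤
      ∑ j ∈ Finset.range N, ‖a j‖ * r ^ d j := by
    refine norm_sum_le_of_le _ fun j _ => ?_
    rw [norm_mul]
    gcongr
    exact norm_polyEval_le hT _ z hz0
  have h2 : (1 - r ^ 2) ^ p ≤ 2 ^ p * (1 - r) ^ p := by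
    rw [← Real.mul_rpow zero_le_two (by linarith)]
    exact Real.rpow_le_rpow (by nlinarith) (by nlinarith) hp.le
  have hterm : ∀ j, 0 ≤ ‖a j‖ ^ 2 * (d j : ℝ) ^ (-p) * r ^ d j := fun j => by positivity
  have hr2 : 0 ≤ 1 - r ^ 2 := by nlinarith
  have hr3 : 0 ≤ 1 - r := by linarith
  calc ENNReal.ofReal (‖∑ j ∈ Finset.range N, a j * polyEval (T (d j)) z‖ ^ 2 * (1 - r ^ 2) ^ p)
      ≤ ENNReal.ofReal (2 ^ p * K *
          ∑ j ∈ Finset.range N, ‖a j‖ ^ 2 * (d j : ℝ) ^ (-p) * r ^ d j) := by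
        refine ENNReal.ofReal_le_ofReal ?_
        calc _ ≤ (∑ j ∈ Finset.range N, ‖a j‖ * r ^ d j) ^ 2 * (2 ^ p * (1 - r) ^ p) := by
              gcongr
          _ = 2 ^ p * ((∑ j ∈ Finset.range N, ‖a j‖ * r ^ d j) ^ 2 * (1 - r) ^ p) := by ring
          _ ≤ 2 ^ p * (K * ∑ j ∈ Finset.range N, ‖a j‖ ^ 2 * (d j : ℝ) ^ (-p) * r ^ d j) := by
              refine mul_le_mul_of_nonneg_left ?_ (by positivity)
              exact hcs r hr0 hz (fun j => ‖a j‖) N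
          _ = _ := by ring
    _ ≤ ENNReal.ofReal (2 ^ p * K) * radialMajorant p d a r := by
        rw [ENNReal.ofReal_mul (by positivity), ENNReal.ofReal_sum_of_nonneg fun j _ => hterm j]
        gcongr
        exact ENNReal.sum_le_tsum _

lemma lintegral_ballMeasure {n : ℕ} (h : Cn n → ℝ≥0∞) :
    ∫⁻ z, h z ∂(ballMeasure n) = (volume (unitBall n))⁻¹ * ∫⁻ z in unitBall n, h z := by
  rw [ballMeasure, ProbabilityTheory.cond, lintegral_smul_measure, smul_eq_mul]

lemma volume_unitBall_ne_zero (n : ℕ) : volume (unitBall n) ≠ 0 :=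
  (Metric.measure_ball_pos volume (0 : Cn n) one_pos).ne'

lemma volume_unitBall_ne_top (n : ℕ) : volume (unitBall n) ≠ ∞ := measure_ball_lt_top.ne

/-- In polar coordinates the radial majorant comes out of the surface integral of the kernel. -/
theorem exists_npIntegral_le {n : ℕ} [NeZero n] {p : ℝ} (hp : 0 < p)
    {T : ℕ → MvPolynomial (Fin n) ℂ} (hT : IsRyllWojtaszczyk T) {d : ℕ → ℕ}
    (hd : IsHadamardGap d) {a : ℕ → ℂ} {f : Cn n → ℂ}
    (hsum : ∀ z ∈ unitBall n, HasSum (fun k => a k * polyEval (T (d k)) z) (f z)) :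
    ∃ C : ℝ≥0∞, C ≠ ∞ ∧ ∀ b : Cn n, ‖b‖ < 1 → npIntegral p f b ≤
      C * ∫⁻ r in Set.Ioo (0 : ℝ) 1, radialMajorant p d a r *
        ∫⁻ ξ : unitSphere n, szegoKernel p b (r • (ξ : Cn n)) ∂(surfMeasure n) := by
  obtain ⟨C, hC, hmaj⟩ := exists_norm_sq_mul_le_radialMajorant hp hT hd hsum
  refine ⟨(volume (unitBall n))⁻¹ * C,
    ENNReal.mul_ne_top (ENNReal.inv_ne_top.2 (volume_unitBall_ne_zero n)) hC, fun b hb => ?_⟩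
  have hb2 := one_sub_norm_sq_pos hb
  rw [npIntegral, lintegral_ballMeasure, mul_assoc]
  gcongr
  have hWm : Measurable fun z : Cn n => radialMajorant p d a ‖z‖ * szegoKernel p b z :=
    ((measurable_radialMajorant p d a).comp measurable_norm).mul (measurable_szegoKernel p b)
  have hpt : ∀ z ∈ unitBall n, z ≠ 0 →
      ENNReal.ofReal (‖f z‖ ^ 2 * (1 - ‖ballAut b z‖ ^ 2) ^ p) ≤
        C * (radialMajorant p d a ‖z‖ * szegoKernel p b z) := by
    intro z hz hz0
    have hz1 : ‖z‖ < 1 := by simpa [unitBall] using hz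
    have hz2 := one_sub_norm_sq_pos hz1
    have e : ‖f z‖ ^ 2 * (1 - ‖ballAut b z‖ ^ 2) ^ p = ‖f z‖ ^ 2 * (1 - ‖z‖ ^ 2) ^ p *
        ((1 - ‖b‖ ^ 2) / ‖1 - inner ℂ b z‖ ^ 2) ^ p := by
      rw [one_sub_norm_ballAut_sq hb hz1, mul_comm (1 - ‖b‖ ^ 2), mul_div_assoc,
        Real.mul_rpow hz2.le (by positivity), mul_assoc]
    rw [e, ENNReal.ofReal_mul (by positivity), ← mul_assoc]
    exact mul_le_mul_left (hmaj z hz0 hz1) _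
  calc ∫⁻ z in unitBall n, ENNReal.ofReal (‖f z‖ ^ 2 * (1 - ‖ballAut b z‖ ^ 2) ^ p)
      ≤ ∫⁻ z in unitBall n, C * (radialMajorant p d a ‖z‖ * szegoKernel p b z) := by
        refine lintegral_mono_ae ?_
        filter_upwards [ae_restrict_mem Metric.isOpen_ball.measurableSet,
          ae_restrict_of_ae (Measure.ae_ne volume (0 : Cn n))] with z hz hz0
        exact hpt z hz hz0
    _ = C * ∫⁻ r in Set.Ioo (0 : ℝ) 1, ENNReal.ofReal (r ^ (2 * n - 1)) *
        ∫⁻ ξ : unitSphere n, radialMajorant p d a ‖r • (ξ : Cn n)‖ *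
          szegoKernel p b (r • (ξ : Cn n)) ∂(surfMeasure n) := by
        rw [lintegral_const_mul' _ _ hC, lintegral_ball_polar hWm]
    _ ≤ _ := by
        gcongr C * ?_
        refine setLIntegral_mono' measurableSet_Ioo fun r hr => ?_
        have hnorm : ∀ ξ : unitSphere n, ‖r • (ξ : Cn n)‖ = r := by
          intro ξ
          simp [norm_smul, abs_of_pos hr.1]
        simp_rw [hnorm]
        have hm : Measurable fun ξ : unitSphere n => szegoKernel p b (r • (ξ : Cn n)) :=
          (measurable_szegoKernel p b).comp (by fun_prop)
        rw [lintegral_const_mul _ hm]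
        refine mul_le_of_le_one_left (zero_le) ?_
        rw [← ENNReal.ofReal_one]
        exact ENNReal.ofReal_le_ofReal (pow_le_one₀ hr.1.le hr.2.le)

theorem memNpZero_of_weightedSum_ne_top {n : ℕ} [NeZero n] {p : ℝ} (hp : 0 < p)
    (hpn : p ≤ (n : ℝ)) {T : ℕ → MvPolynomial (Fin n) ℂ} (hT : IsRyllWojtaszczyk T) {d : ℕ → ℕ}
    (hd : IsHadamardGap d) {a : ℕ → ℂ} {f : Cn n → ℂ} (hf : DifferentiableOn ℂ f (unitBall n))
    (hsum : ∀ z ∈ unitBall n, HasSum (fun k => a k * polyEval (T (d k)) z) (f z))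
    (hW : weightedSum p d a ≠ ∞) : MemNpZero p f := by
  obtain ⟨C, hC, hint⟩ := exists_npIntegral_le hp hT hd hsum
  obtain ⟨M, hM, hker⟩ := exists_lintegral_szegoKernel_le hp hpn
  have hmaj : ∫⁻ r in Set.Ioo (0 : ℝ) 1, radialMajorant p d a r ≠ ∞ :=
    ((lintegral_radialMajorant_le hd.1 a).trans_lt hW.lt_top).ne
  have hbd : ∫⁻ r in Set.Ioo (0 : ℝ) 1, radialMajorant p d a r * M ≠ ∞ := by
    rw [lintegral_mul_const' _ _ hM]
    exact ENNReal.mul_ne_top hmaj hM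
  refine ⟨⟨hf, ?_⟩, ?_⟩
  · refine lt_of_le_of_lt (b := (C * ∫⁻ r in Set.Ioo (0 : ℝ) 1, radialMajorant p d a r * M) ^
      (1 / 2 : ℝ)) (iSup₂_le fun b hb => ?_)
      (ENNReal.rpow_lt_top_of_nonneg (by norm_num) (ENNReal.mul_ne_top hC hbd))
    have hb1 : ‖b‖ < 1 := by simpa [unitBall] using hb
    refine ENNReal.rpow_le_rpow ((hint b hb1).trans ?_) (by norm_num)
    gcongr C * ?_
    refine setLIntegral_mono' measurableSet_Ioo fun r hr => ?_
    gcongr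
    exact hker b hb1 r hr.1.le hr.2
  · -- the surface integrals of the kernel, bounded by a function of `t = |b|` and `r`
    let k : ℝ → ℝ → ℝ≥0∞ := fun t r =>
      min M (ENNReal.ofReal (((1 - t ^ 2) / (1 - r) ^ 2) ^ p) * surfMeasure n Set.univ)
    have hdct : Tendsto (fun t => ∫⁻ r in Set.Ioo (0 : ℝ) 1, radialMajorant p d a r * k t r)
        (𝓝[<] 1) (𝓝 (∫⁻ r in Set.Ioo (0 : ℝ) 1, 0)) := by
      refine tendsto_lintegral_filter_of_dominated_convergence
        (fun r => radialMajorant p d a r * M) ?_ ?_ hbd ?_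
      · refine Eventually.of_forall fun t => (measurable_radialMajorant p d a).mul ?_
        refine measurable_const.min (Measurable.mul_const ?_ _)
        have : Measurable fun r : ℝ => (1 - t ^ 2) / (1 - r) ^ 2 := by fun_prop
        exact (this.pow_const p).ennreal_ofReal
      · refine Eventually.of_forall fun t => Eventually.of_forall fun r => ?_
        gcongr
        exact min_le_left _ _
      · have hfin : ∀ᵐ r ∂(volume.restrict (Set.Ioo (0 : ℝ) 1)), radialMajorant p d a r < ∞ :=
          ae_lt_top (measurable_radialMajorant p d a) hmaj
        filter_upwards [hfin, ae_restrict_mem measurableSet_Ioo] with r hr hr1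
        have h1 : Tendsto (fun t : ℝ => ((1 - t ^ 2) / (1 - r) ^ 2) ^ p) (𝓝[<] 1) (𝓝 0) := by
          have hc : ContinuousAt (fun t : ℝ => ((1 - t ^ 2) / (1 - r) ^ 2) ^ p) 1 := by
            refine ContinuousAt.rpow_const (by fun_prop) (Or.inr hp.le)
          have := hc.tendsto.mono_left (nhdsWithin_le_nhds (s := Set.Iio 1))
          simpa [hp.ne'] using this
        have h2 := ENNReal.Tendsto.mul_const (ENNReal.tendsto_ofReal h1)
          (Or.inr (measure_ne_top (surfMeasure n) Set.univ))
        rw [ENNReal.ofReal_zero, zero_mul] at h2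
        have h3 : Tendsto (fun t => k t r) (𝓝[<] 1) (𝓝 0) :=
          tendsto_of_tendsto_of_tendsto_of_le_of_le tendsto_const_nhds h2
            (fun _ => zero_le) fun t => min_le_right _ _
        simpa using ENNReal.Tendsto.const_mul h3 (Or.inr hr.ne)
    rw [lintegral_zero] at hdct
    have hlim := (ENNReal.Tendsto.const_mul hdct (Or.inr hC)).comp
      (tendsto_comap (f := fun b : Cn n => ‖b‖))
    rw [mul_zero] at hlim
    refine tendsto_of_tendsto_of_tendsto_of_le_of_le' tendsto_const_nhds hlim
      (Eventually.of_forall fun _ => zero_le) ?_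
    have hev : ∀ᶠ b : Cn n in comap (fun b : Cn n => ‖b‖) (𝓝[<] 1), ‖b‖ < 1 :=
      tendsto_comap.eventually (eventually_mem_nhdsWithin (s := Set.Iio (1 : ℝ)))
    filter_upwards [hev] with b hb
    refine (hint b hb).trans ?_
    simp only [Function.comp_apply]
    gcongr C * ?_
    refine setLIntegral_mono' measurableSet_Ioo fun r hr => ?_
    gcongr
    refine le_min (hker b hb r hr.1.le hr.2) ?_
    rw [← lintegral_const]
    refine lintegral_mono fun ξ => ?_
    have hnorm : ‖r • (ξ : Cn n)‖ = r := by simp [norm_smul, abs_of_pos hr.1]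
    have := szegoKernel_le hp (z := r • (ξ : Cn n)) hb (by rw [hnorm]; exact hr.2)
    rwa [hnorm] at this

/-! ### From the function to the coefficients -/

/-- Bessel's inequality for an absolutely convergent lacunary Fourier series, stated for its
pointwise sum. -/
theorem tsum_norm_sq_le_lintegral_addCircle {c : ℕ → ℂ} {d : ℕ → ℕ} (hd : Function.Injective d)
    (hc : Summable fun j => ‖c j‖) {g : UnitAddCircle → ℂ}
    (hg : ∀ θ, HasSum (fun j => c j * fourier (d j) θ) (g θ)) :
    ∑' j, ENNReal.ofReal (‖c j‖ ^ 2) ≤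
      ∫⁻ θ, ENNReal.ofReal (‖g θ‖ ^ 2) ∂(AddCircle.haarAddCircle (T := 1)) := by
  let F : ℕ → C(UnitAddCircle, ℂ) := fun j => c j • fourier (d j)
  have hF : Summable F := by
    refine Summable.of_norm ?_
    simpa only [F, norm_smul, fourier_norm, mul_one] using hc
  obtain ⟨H, hH⟩ := hF
  have hHg : ∀ θ, H θ = g θ := fun θ =>
    (((ContinuousMap.evalCLM ℂ θ).hasSum hH).unique (hg θ) :)
  let L := ContinuousMap.toLp (E := ℂ) 2 (AddCircle.haarAddCircle (T := 1)) ℂ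
  let v : ℕ → Lp ℂ 2 (AddCircle.haarAddCircle (T := 1)) := fun j => fourierLp 2 (d j : ℤ)
  have hv : Orthonormal ℂ v :=
    orthonormal_fourier.comp (fun j => (d j : ℤ)) (Nat.cast_injective.comp hd)
  have hLH : HasSum (fun j => c j • v j) (L H) := by
    have := L.hasSum hH
    simpa [F, v, L, fourierLp, Function.comp_def] using this
  have hcoef : ∀ j, inner ℂ (v j) (L H) = c j := by
    intro j
    have h1 := (innerSL ℂ (v j)).hasSum hLH
    have h2 := hasSum_single (f := fun i => innerSL ℂ (v j) (c i • v i)) j fun i hi => by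
      simp [hv.2 hi.symm]
    refine (h1.unique h2).trans ?_
    simp [hv.1 j, inner_self_eq_norm_sq_to_K]
  have hnorm : ENNReal.ofReal (‖L H‖ ^ 2) =
      ∫⁻ θ, ENNReal.ofReal (‖g θ‖ ^ 2) ∂(AddCircle.haarAddCircle (T := 1)) := by
    have hint : Integrable (fun θ => ‖H θ‖ ^ 2) (AddCircle.haarAddCircle (T := 1)) :=
      Continuous.integrable_of_hasCompactSupport (by fun_prop)
        (HasCompactSupport.of_compactSpace _)
    simp_rw [← hHg]
    rw [← ofReal_integral_eq_lintegral_ofReal hint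
      (Eventually.of_forall fun θ => by positivity)]
    congr 1
    have h1 : ((‖L H‖ ^ 2 : ℝ) : ℂ) =
        ((∫ θ, ‖H θ‖ ^ 2 ∂(AddCircle.haarAddCircle (T := 1)) : ℝ) : ℂ) := by
      have h2 := ContinuousMap.inner_toLp (𝕜 := ℂ) (AddCircle.haarAddCircle (T := 1)) H H
      rw [inner_self_eq_norm_sq_to_K] at h2
      rw [← integral_complex_ofReal]
      push_cast
      refine Eq.trans h2 (integral_congr_ae (Eventually.of_forall fun θ => ?_))
      simp [Complex.mul_conj, Complex.normSq_eq_norm_sq]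
    exact_mod_cast h1
  rw [← hnorm]
  refine ENNReal.tsum_le_of_sum_range_le fun N => ?_
  rw [← ENNReal.ofReal_sum_of_nonneg fun _ _ => by positivity]
  refine ENNReal.ofReal_le_ofReal ?_
  have := hv.sum_inner_products_le (L H) (s := Finset.range N)
  simpa only [hcoef] using this

lemma IsHadamardGap.strictMono {d : ℕ → ℕ} (hd : IsHadamardGap d) : StrictMono d := by
  obtain ⟨c, hc, h⟩ := hd.mul_le
  refine strictMono_nat_of_lt_succ fun k => ?_
  have h0 : (0 : ℝ) < d k := by exact_mod_cast hd.1 k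
  have : (d k : ℝ) < d (k + 1) := by nlinarith [h k]
  exact_mod_cast this

/-- Volume is invariant under the circle action `z ↦ e^{iθ} z`. -/
lemma lintegral_circle_smul {n : ℕ} (u : Circle) {h : Cn n → ℝ≥0∞} (hh : Measurable h) :
    ∫⁻ z, h ((u : ℂ) • z) = ∫⁻ z, h z := by
  let e : Cn n ≃ₗᵢ[ℂ] Cn n :=
    { LinearEquiv.smulOfNeZero ℂ (Cn n) (u : ℂ) u.coe_ne_zero with
      norm_map' := fun z => by
        change ‖(u : ℂ) • z‖ = ‖z‖
        rw [norm_smul, Circle.norm_coe, one_mul] }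
  have hmp : MeasurePreserving (fun z : Cn n => (u : ℂ) • z) volume volume :=
    LinearIsometryEquiv.measurePreserving (E := Cn n) (F := Cn n)
      { e.toLinearEquiv.restrictScalars ℝ with norm_map' := e.norm_map }
  exact hmp.lintegral_comp hh

/-- Averaging over the circle action and Bessel's inequality on each slice. -/
theorem tsum_lintegral_le {n : ℕ} {p : ℝ} (hp : 0 < p) {T : ℕ → MvPolynomial (Fin n) ℂ}
    (hT : IsRyllWojtaszczyk T) {d : ℕ → ℕ} (hd : IsHadamardGap d) {a : ℕ → ℂ} {f : Cn n → ℂ}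
    (hf : DifferentiableOn ℂ f (unitBall n))
    (hsum : ∀ z ∈ unitBall n, HasSum (fun k => a k * polyEval (T (d k)) z) (f z)) :
    ∑' j, ENNReal.ofReal (‖a j‖ ^ 2) * ∫⁻ z in unitBall n,
        ENNReal.ofReal (‖polyEval (T (d j)) z‖ ^ 2 * (1 - ‖z‖ ^ 2) ^ p) ≤
      ∫⁻ z in unitBall n, ENNReal.ofReal (‖f z‖ ^ 2 * (1 - ‖z‖ ^ 2) ^ p) := by
  have hB : MeasurableSet (unitBall n) := Metric.isOpen_ball.measurableSet
  set h : Cn n → ℝ≥0∞ :=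
    (unitBall n).indicator fun z => ENNReal.ofReal (‖f z‖ ^ 2 * (1 - ‖z‖ ^ 2) ^ p) with hdef
  have hh : Measurable h := by
    have hc : ContinuousOn (fun z => ENNReal.ofReal (‖f z‖ ^ 2 * (1 - ‖z‖ ^ 2) ^ p))
        (unitBall n) := by
      refine ENNReal.continuous_ofReal.comp_continuousOn ?_
      refine (hf.continuousOn.norm.pow 2).mul ?_
      exact (ContinuousOn.rpow_const (by fun_prop) fun _ _ => Or.inr hp.le)
    classical
    rw [hdef, ← Set.piecewise_eq_indicator]
    exact hc.measurable_piecewise continuousOn_const hB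
  let μ := AddCircle.haarAddCircle (T := 1)
  have hm2 : Measurable fun y : UnitAddCircle × Cn n =>
      h ((AddCircle.toCircle y.1 : ℂ) • y.2) := by
    refine hh.comp (Continuous.measurable ?_)
    have : Continuous fun y : UnitAddCircle × Cn n => (AddCircle.toCircle y.1 : ℂ) :=
      continuous_subtype_val.comp (AddCircle.continuous_toCircle.comp continuous_fst)
    fun_prop
  have hmT : ∀ j, Measurable fun z : Cn n =>
      ENNReal.ofReal (‖polyEval (T (d j)) z‖ ^ 2 * (1 - ‖z‖ ^ 2) ^ p) := by
    intro j
    have h1 := continuous_polyEval (T (d j))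
    have h2 : Continuous fun z : Cn n => 1 - ‖z‖ ^ 2 := by fun_prop
    exact ((h1.norm.pow 2).measurable.mul (h2.measurable.pow_const p)).ennreal_ofReal
  calc ∑' j, ENNReal.ofReal (‖a j‖ ^ 2) * ∫⁻ z in unitBall n,
        ENNReal.ofReal (‖polyEval (T (d j)) z‖ ^ 2 * (1 - ‖z‖ ^ 2) ^ p)
      = ∫⁻ z in unitBall n, ∑' j, ENNReal.ofReal (‖a j‖ ^ 2) *
          ENNReal.ofReal (‖polyEval (T (d j)) z‖ ^ 2 * (1 - ‖z‖ ^ 2) ^ p) := by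
        rw [lintegral_tsum fun j => ((hmT j).const_mul _).aemeasurable]
        simp_rw [lintegral_const_mul' _ _ ENNReal.ofReal_ne_top]
    _ ≤ ∫⁻ z in unitBall n, ∫⁻ θ, h ((AddCircle.toCircle θ : ℂ) • z) ∂μ := by
        refine setLIntegral_mono' hB fun z hz => ?_
        have hz1 : ‖z‖ < 1 := by simpa [unitBall] using hz
        have hw : 0 ≤ (1 - ‖z‖ ^ 2) ^ p := Real.rpow_nonneg (one_sub_norm_sq_pos hz1).le p
        have hrot : ∀ θ : UnitAddCircle, ‖(AddCircle.toCircle θ : ℂ) • z‖ = ‖z‖ := by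
          intro θ
          rw [norm_smul, Circle.norm_coe, one_mul]
        have hmem : ∀ θ : UnitAddCircle, (AddCircle.toCircle θ : ℂ) • z ∈ unitBall n := by
          intro θ
          simpa [unitBall, hrot θ] using hz1
        have hbessel := tsum_norm_sq_le_lintegral_addCircle
          (c := fun j => a j * polyEval (T (d j)) z)
          (g := fun θ => f ((AddCircle.toCircle θ : ℂ) • z)) hd.strictMono.injective
          (hsum z hz).summable.norm (fun θ => by
            convert hsum _ (hmem θ) using 2 with j
            rw [polyEval_smul (hT.homogeneous _), fourier_apply, natCast_zsmul,
              AddCircle.toCircle_nsmul, Circle.coe_pow]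
            ring)
        calc ∑' j, ENNReal.ofReal (‖a j‖ ^ 2) *
              ENNReal.ofReal (‖polyEval (T (d j)) z‖ ^ 2 * (1 - ‖z‖ ^ 2) ^ p)
            = (∑' j, ENNReal.ofReal (‖a j * polyEval (T (d j)) z‖ ^ 2)) *
                ENNReal.ofReal ((1 - ‖z‖ ^ 2) ^ p) := by
              rw [← ENNReal.tsum_mul_right]
              refine tsum_congr fun j => ?_
              rw [← ENNReal.ofReal_mul (by positivity), ← ENNReal.ofReal_mul (by positivity),
                norm_mul, mul_pow, mul_assoc]
          _ ≤ (∫⁻ θ, ENNReal.ofReal (‖f ((AddCircle.toCircle θ : ℂ) • z)‖ ^ 2) ∂μ) *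
                ENNReal.ofReal ((1 - ‖z‖ ^ 2) ^ p) := by gcongr
          _ = ∫⁻ θ, h ((AddCircle.toCircle θ : ℂ) • z) ∂μ := by
              rw [← lintegral_mul_const' _ _ ENNReal.ofReal_ne_top]
              refine lintegral_congr fun θ => ?_
              rw [hdef, Set.indicator_of_mem (hmem θ), hrot, ENNReal.ofReal_mul (by positivity)]
    _ ≤ ∫⁻ z, ∫⁻ θ, h ((AddCircle.toCircle θ : ℂ) • z) ∂μ := setLIntegral_le_lintegral _ _
    _ = ∫⁻ θ, ∫⁻ z, h ((AddCircle.toCircle θ : ℂ) • z) ∂volume ∂μ :=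
        (lintegral_lintegral_swap hm2.aemeasurable).symm
    _ = ∫⁻ z, h z := by
        simp_rw [lintegral_circle_smul _ hh]
        rw [lintegral_const, measure_univ, mul_one]
    _ = _ := by rw [hdef, lintegral_indicator hB]

/-- A lower bound for the Beta integral, from the interval `1 - r ∈ (1/(4M), 1/(2M))`. -/
lemma le_lintegral_Ioo_beta {p : ℝ} (hp : 0 < p) {N : ℕ} {M : ℝ} (hM : 1 ≤ M) (hN : N ≤ M) :
    ENNReal.ofReal (1 / 2 * (4 * M) ^ (-(1 + p))) ≤
      ∫⁻ r in Set.Ioo (0 : ℝ) 1, ENNReal.ofReal (r ^ N * (1 - r ^ 2) ^ p) := by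
  have hM0 : 0 < M := by linarith
  set δ := (4 * M)⁻¹ with hδ
  have hδ0 : 0 < δ := by positivity
  have hδM : M * δ = 1 / 4 := by rw [hδ]; field_simp
  have hδ1 : δ ≤ 1 / 4 := by nlinarith
  have hsub : Set.Ioo (1 - 2 * δ) (1 - δ) ⊆ Set.Ioo (0 : ℝ) 1 :=
    Set.Ioo_subset_Ioo (by linarith) (by linarith)
  have hpow : (4 * M) ^ (-(1 + p)) = δ ^ p * δ := by
    rw [Real.rpow_neg (by positivity), ← Real.inv_rpow (by positivity), ← hδ, add_comm,
      Real.rpow_add_one hδ0.ne']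
  calc ENNReal.ofReal (1 / 2 * (4 * M) ^ (-(1 + p)))
      = ∫⁻ r in Set.Ioo (1 - 2 * δ) (1 - δ), ENNReal.ofReal (1 / 2 * δ ^ p) := by
        rw [setLIntegral_const, Real.volume_Ioo, ← ENNReal.ofReal_mul (by positivity), hpow]
        congr 1; ring
    _ ≤ ∫⁻ r in Set.Ioo (1 - 2 * δ) (1 - δ), ENNReal.ofReal (r ^ N * (1 - r ^ 2) ^ p) := by
        refine setLIntegral_mono' measurableSet_Ioo fun r hr => ENNReal.ofReal_le_ofReal ?_
        have hr0 : 0 < r := (hsub hr).1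
        have hr1 : r < 1 := (hsub hr).2
        have h1 : 1 / 2 ≤ r ^ N := by
          have hb := one_add_mul_le_pow (a := -(2 * δ)) (by linarith) N
          have h3 : (1 + -(2 * δ)) ^ N ≤ r ^ N :=
            pow_le_pow_left₀ (by linarith) (by linarith [hr.1]) N
          have h4 : (N : ℝ) * δ ≤ M * δ := by gcongr
          linarith
        have h2 : δ ^ p ≤ (1 - r ^ 2) ^ p :=
          Real.rpow_le_rpow hδ0.le (by nlinarith [hr.2]) hp.le
        gcongr
    _ ≤ _ := lintegral_mono_set hsub

lemma surfMeasure_univ_ne_zero (n : ℕ) [NeZero n] : surfMeasure n Set.univ ≠ 0 :=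
  Measure.measure_univ_ne_zero.2 (Measure.toSphere_ne_zero _)

/-- The lower `L²` bound of a Ryll–Wojtaszczyk polynomial for the unnormalized measure. -/
lemma le_lintegral_polyEval {n : ℕ} [NeZero n] {T : ℕ → MvPolynomial (Fin n) ℂ}
    (hT : IsRyllWojtaszczyk T) (k : ℕ) :
    surfMeasure n Set.univ * ENNReal.ofReal (Real.pi / 2 ^ (2 * n)) ≤
      ∫⁻ ξ : unitSphere n, ENNReal.ofReal (‖polyEval (T k) ξ‖ ^ 2) ∂(surfMeasure n) := by
  have hne := surfMeasure_univ_ne_zero n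
  have hfin : surfMeasure n Set.univ ≠ ∞ := measure_ne_top _ _
  have hc : Continuous fun ξ : unitSphere n => ‖polyEval (T k) ξ‖ ^ 2 :=
    (((continuous_polyEval (T k)).comp continuous_subtype_val).norm.pow 2)
  have h1 : ENNReal.ofReal (Real.pi / 2 ^ (2 * n)) ≤
      ∫⁻ ξ : unitSphere n, ENNReal.ofReal (‖polyEval (T k) ξ‖ ^ 2) ∂(sphereMeasure n) := by
    refine (ENNReal.ofReal_le_ofReal (hT.le_l2 k)).trans ?_
    rw [integral_eq_lintegral_of_nonneg_ae (Eventually.of_forall fun _ => by positivity)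
      hc.aestronglyMeasurable]
    exact ENNReal.ofReal_toReal_le
  rw [sphereMeasure, lintegral_smul_measure, smul_eq_mul] at h1
  calc _ ≤ surfMeasure n Set.univ * ((surfMeasure n Set.univ)⁻¹ *
        ∫⁻ ξ : unitSphere n, ENNReal.ofReal (‖polyEval (T k) ξ‖ ^ 2) ∂(surfMeasure n)) := by
        gcongr
    _ = _ := by rw [← mul_assoc, ENNReal.mul_inv_cancel hne hfin, one_mul]

/-- The lower bounds for the radial and the spherical part of the integral, combined. -/
theorem exists_le_lintegral_polyEval_ball {n : ℕ} [NeZero n] {p : ℝ} (hp : 0 < p)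
    {T : ℕ → MvPolynomial (Fin n) ℂ} (hT : IsRyllWojtaszczyk T) :
    ∃ c : ℝ≥0∞, c ≠ 0 ∧ ∀ k : ℕ, 0 < k → c * ENNReal.ofReal ((k : ℝ) ^ (-(1 + p))) ≤
      ∫⁻ z in unitBall n, ENNReal.ofReal (‖polyEval (T k) z‖ ^ 2 * (1 - ‖z‖ ^ 2) ^ p) := by
  have hn : (1 : ℝ) ≤ n := by exact_mod_cast NeZero.one_le (n := n)
  set c₁ : ℝ := 1 / 2 * (16 * n) ^ (-(1 + p)) with hc₁
  have hc₁0 : 0 < c₁ := by positivity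
  set c₂ := surfMeasure n Set.univ * ENNReal.ofReal (Real.pi / 2 ^ (2 * n)) with hc₂
  have hc₂0 : c₂ ≠ 0 := by
    refine mul_ne_zero (surfMeasure_univ_ne_zero n) ?_
    have : 0 < Real.pi / 2 ^ (2 * n) := by positivity
    simpa using this
  refine ⟨ENNReal.ofReal c₁ * c₂, mul_ne_zero (by simpa using hc₁0) hc₂0, fun k hk => ?_⟩
  have hk1 : (1 : ℝ) ≤ k := by exact_mod_cast hk
  have hm : Measurable fun z : Cn n =>
      ENNReal.ofReal (‖polyEval (T k) z‖ ^ 2 * (1 - ‖z‖ ^ 2) ^ p) := by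
    have h1 := continuous_polyEval (T k)
    have h2 : Continuous fun z : Cn n => 1 - ‖z‖ ^ 2 := by fun_prop
    exact ((h1.norm.pow 2).measurable.mul (h2.measurable.pow_const p)).ennreal_ofReal
  have hrad : ∀ r ∈ Set.Ioo (0 : ℝ) 1, ENNReal.ofReal (r ^ (2 * n - 1)) *
      ∫⁻ ξ : unitSphere n, ENNReal.ofReal (‖polyEval (T k) (r • (ξ : Cn n))‖ ^ 2 *
        (1 - ‖r • (ξ : Cn n)‖ ^ 2) ^ p) ∂(surfMeasure n) =
      ENNReal.ofReal (r ^ (2 * n - 1 + 2 * k) * (1 - r ^ 2) ^ p) *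
        ∫⁻ ξ : unitSphere n, ENNReal.ofReal (‖polyEval (T k) ξ‖ ^ 2) ∂(surfMeasure n) := by
    intro r hr
    have hr0 : 0 < r := hr.1
    have hw : 0 ≤ (1 - r ^ 2) ^ p := Real.rpow_nonneg (by nlinarith [hr.2]) p
    rw [← lintegral_const_mul' _ _ ENNReal.ofReal_ne_top,
      ← lintegral_const_mul' _ _ ENNReal.ofReal_ne_top]
    refine lintegral_congr fun ξ => ?_
    have hnorm : ‖r • (ξ : Cn n)‖ = r := by simp [norm_smul, abs_of_pos hr0]
    rw [hnorm, ← Complex.coe_smul, polyEval_smul (hT.homogeneous k),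
      ← ENNReal.ofReal_mul (by positivity), ← ENNReal.ofReal_mul (by positivity), norm_mul,
      norm_pow, Complex.norm_real, Real.norm_of_nonneg hr0.le]
    congr 1
    ring
  rw [lintegral_ball_polar hm, setLIntegral_congr_fun measurableSet_Ioo hrad]
  calc ENNReal.ofReal c₁ * c₂ * ENNReal.ofReal ((k : ℝ) ^ (-(1 + p)))
      = ENNReal.ofReal (1 / 2 * (4 * (4 * n * k)) ^ (-(1 + p))) * c₂ := by
        rw [mul_right_comm, ← ENNReal.ofReal_mul hc₁0.le, hc₁, mul_assoc,
          ← Real.mul_rpow (by positivity) (by positivity)]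
        congr 4; ring
    _ ≤ (∫⁻ r in Set.Ioo (0 : ℝ) 1,
          ENNReal.ofReal (r ^ (2 * n - 1 + 2 * k) * (1 - r ^ 2) ^ p)) *
        ∫⁻ ξ : unitSphere n, ENNReal.ofReal (‖polyEval (T k) ξ‖ ^ 2) ∂(surfMeasure n) := by
        refine mul_le_mul' (le_lintegral_Ioo_beta hp (by nlinarith) ?_)
          (le_lintegral_polyEval hT k)
        have h1 : ((2 * n - 1 + 2 * k : ℕ) : ℝ) ≤ 2 * n + 2 * k := by
          exact_mod_cast (by omega : 2 * n - 1 + 2 * k ≤ 2 * n + 2 * k)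
        nlinarith
    _ ≤ _ := by
        rw [lintegral_mul_const'']
        have h2 : Measurable fun r : ℝ => 1 - r ^ 2 := by fun_prop
        exact ((by fun_prop : Measurable fun r : ℝ => r ^ (2 * n - 1 + 2 * k)).mul
          (h2.pow_const p)).ennreal_ofReal.aemeasurable

/-- Testing the norm at `a = 0` already gives the coefficient condition. -/
theorem weightedSum_ne_top_of_memNp {n : ℕ} [NeZero n] {p : ℝ} (hp : 0 < p)
    {T : ℕ → MvPolynomial (Fin n) ℂ} (hT : IsRyllWojtaszczyk T) {d : ℕ → ℕ}
    (hd : IsHadamardGap d) {a : ℕ → ℂ} {f : Cn n → ℂ}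
    (hsum : ∀ z ∈ unitBall n, HasSum (fun k => a k * polyEval (T (d k)) z) (f z))
    (hf : MemNp p f) : weightedSum p d a ≠ ∞ := by
  obtain ⟨c, hc, hlow⟩ := exists_le_lintegral_polyEval_ball hp hT
  have h0 : npIntegral p f 0 ^ (1 / 2 : ℝ) < ∞ :=
    (le_iSup₂ (f := fun b (_ : b ∈ unitBall n) => npIntegral p f b ^ (1 / 2 : ℝ)) 0
      (by simp [unitBall])).trans_lt hf.2
  have h1 : npIntegral p f 0 < ∞ := by
    rwa [ENNReal.rpow_lt_top_iff_of_pos (by norm_num)] at h0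
  rw [npIntegral, lintegral_ballMeasure] at h1
  simp_rw [norm_ballAut_zero] at h1
  have h2 : ∫⁻ z in unitBall n, ENNReal.ofReal (‖f z‖ ^ 2 * (1 - ‖z‖ ^ 2) ^ p) ≠ ∞ := by
    intro htop
    rw [htop, ENNReal.mul_top (ENNReal.inv_ne_zero.2 (volume_unitBall_ne_top n))] at h1
    exact lt_irrefl _ h1
  have h3 : c * weightedSum p d a ≠ ∞ := by
    refine ne_top_of_le_ne_top h2 (le_trans ?_ (tsum_lintegral_le hp hT hd hf.1 hsum))
    rw [weightedSum, ← ENNReal.tsum_mul_left]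
    refine ENNReal.tsum_le_tsum fun j => ?_
    rw [ENNReal.ofReal_mul (by positivity), mul_left_comm]
    gcongr
    exact hlow (d j) (hd.1 j)
  intro htop
  rw [htop, ENNReal.mul_top hc] at h3
  exact h3 rfl

end HadamardNp

theorem mainTheorem3 (n : ℕ) (p : ℝ) (hp : 0 < p) (hpn : p ≤ (n : ℝ))
    (T : ℕ → MvPolynomial (Fin n) ℂ) (hT : HadamardNp.IsRyllWojtaszczyk T)
    (d : ℕ → ℕ) (hd : HadamardNp.IsHadamardGap d) (a : ℕ → ℂ)
    (f : HadamardNp.Cn n → ℂ)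
    (hf : DifferentiableOn ℂ f (HadamardNp.unitBall n))
    (hsum : ∀ z ∈ HadamardNp.unitBall n,
      HasSum (fun k => a k * HadamardNp.polyEval (T (d k)) z) (f z)) :
    List.TFAE
      [HadamardNp.dyadicSum p d a < ∞,
       HadamardNp.MemNpZero p f,
       HadamardNp.MemNp p f] := by
  have : NeZero n := ⟨by rintro rfl; norm_num at hpn; linarith⟩
  tfae_have 1 → 2 := fun h => HadamardNp.memNpZero_of_weightedSum_ne_top hp hpn hT hd hf hsum
    ((HadamardNp.weightedSum_le_dyadicSum hp hd.1 a).trans_lt h).ne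
  tfae_have 2 → 3 := fun h => h.1
  tfae_have 3 → 1 := fun h => (HadamardNp.dyadicSum_le_weightedSum hp hd.1 a).trans_lt
    (ENNReal.mul_lt_top ENNReal.ofReal_lt_top
      (HadamardNp.weightedSum_ne_top_of_memNp hp hT hd hsum h).lt_top)
  tfae_finish
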